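/- Let $m\ge 2$ and $n\ge 0$ be integers and $0<\epsilon<\pi/2$. Let $\Omega_\epsilon=\{t\in\mathbb C\mid \pi/2+\epsilon<\arg t<3\pi/2-\epsilon\}$, let $\mathcal H_n$ be the space of $n\times n$ Hermitian matrices $X=[x_{ij}]$ with the volume form $d\mu(X)=\prod_i dx_{ii}\prod_{i<j}d(\mathrm{Re}\,x_{ij})\,d(\mathrm{Im}\,x_{ij})$, and let $$Z_n(t,m)=\int_{\mathcal H_n}\exp\Big(-\tfrac12\operatorname{tr}X^2\Big)\exp\Big(\operatorname{tr}\sum_{j=3}^{2m}\frac{t_j}{j}X^j\Big)\frac{d\mu(X)}{N},\qquad N=\int_{\mathcal H_n}\exp\Big(-\tfrac12\operatorname{tr}X^2\Big)d\mu(X).$$ A ribbon graph is a finite (possibly empty or disconnected) graph, loops and multiple edges allowed, with a cyclic order of the half-edges at each vertex. For a ribbon graph $\Gamma$, let $v_j(\Gamma)$ be the number of vertices of degree $j$ and $b(\Gamma)$ the number of boundary components of the oriented surface obtained by fattening $\Gamma$, i.e. the number of cycles of the permutation of the half-edges that takes a half-edge $h$ to the half-edge following, in the cyclic order, the other half of the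 edge of $h$. Given $v_3,\dots,v_{2m}$, take $v_j$ crossroads with $j$ cyclically ordered dots each, for every $j$. The group $\prod_j\big(\mathfrak S_{v_j}\rtimes(\mathbb Z/j\mathbb Z)^{v_j}\big)$, which permutes the crossroads of equal degree and rotates each of them, acts on the set of pairing schemes (partitions of the set of all dots into pairs). A pairing scheme defines a ribbon graph, whose vertices are the crossroads and whose edges are the pairs. $\mathrm{Aut}(\Gamma)$ is the isotropy group of a pairing scheme whose ribbon graph is isomorphic to $\Gamma$; up to conjugation it does not depend on the choice of the scheme. **Theorem 2.4.** The integral $Z_n(t,m)$ converges absolutely whenever $t_{2m}\in\Omega_\epsilon$, and it is holomorphic in $(t_3,\dots,t_{2m-1},t_{2m})\in\mathbb C^{2m-3}\times\Omega_\epsilon$. Its expansion as a convergent power series in $t_3,\dots,t_{2m-1}$ about $0$, and as an asymptotic series in $t_{2m}\in\Omega_\epsilon$ at $t_{2m}=0$, is $$\mathcal A\big(Z_n(t,m)\big)=\sum_{\Gamma}\frac{1}{|\mathrm{Aut}(\Gamma)|}\,n^{b(\Gamma)}\prod_{j=3}^{2m}t_j^{v_j(\Gamma)},$$ where $\Gamma$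 runs over the isomorphism classes of ribbon graphs all of whose vertices have degree $3,4,\dots,2m$ (finitely many for given $v_3,\dots,v_{2m}$, so that the series lies in $\mathbb Q[n][[t_3,\dots,t_{2m}]]$). That is: for every $t_{2m}\in\Omega_\epsilon$ and all $t_3,\dots,t_{2m-1}\in\mathbb C$, $$Z_n(t,m)=\sum_{v_3,\dots,v_{2m-1}\ge0}c_{v_3,\dots,v_{2m-1}}(t_{2m})\,t_3^{v_3}\cdots t_{2m-1}^{v_{2m-1}},$$ and each $c=c_{v_3,\dots,v_{2m-1}}$ is holomorphic on $\Omega_\epsilon$ and has there the asymptotic expansion $\sum_k a_kz^k$, i.e. $\lim_{z\to0,\,z\in\Omega_\epsilon}\big(c(z)-\sum_{k=0}^Ma_kz^k\big)/z^{M+1}=a_{M+1}$ for all $M\ge0$, where $a_k$ is the sum of $n^{b(\Gamma)}/|\mathrm{Aut}(\Gamma)|$ over the classes with $v_j(\Gamma)=v_j$ for $3\le j<2m$ and $v_{2m}(\Gamma)=k$. (Here $0^0=1$.) -/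

import Mathlib

open MeasureTheory Filter Topology Polynomial

noncomputable section

/-! ### Asymptotic expansions -/

/-- The open sector `Ω_ε = {t ∈ ℂ | π/2 + ε < arg t < 3π/2 - ε}`. -/
def sector (ε : ℝ) : Set ℂ :=
  {t | ∃ r θ : ℝ, 0 < r ∧ Real.pi / 2 + ε < θ ∧ θ < 3 * Real.pi / 2 - ε ∧
    t = r * Complex.exp (θ * Complex.I)}

/-- `∑ a_k z^k` is the asymptotic expansion at `z = 0` of the holomorphic function `h` on the
open domain `Ω`, which has the origin on its boundary. -/
structure HasAsymptoticExpansion (Ω : Set ℂ) (h : ℂ → ℂ) (a : ℕ → ℂ) : Prop where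
  isOpen : IsOpen Ω
  isPreconnected : IsPreconnected Ω
  zero_mem_frontier : (0 : ℂ) ∈ frontier Ω
  holomorphic : DifferentiableOn ℂ h Ω
  tendsto : ∀ M : ℕ, Tendsto
    (fun z => (h z - ∑ k ∈ Finset.range (M + 1), a k * z ^ k) / z ^ (M + 1))
    (𝓝[Ω] 0) (𝓝 (a (M + 1)))

/-- The formal power series `A` in the variables `t_i`, `i : τ`, is the expansion of `F` as a
convergent power series about `0` in all the variables `t_i` with `i ≠ i₀`, and as an asymptotic
series at `0` in the remaining variable `t_{i₀} ∈ Ω`: the function `F` is holomorphic on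
`{t | t_{i₀} ∈ Ω}`; for `t_{i₀} ∈ Ω` it is the sum of a power series in the other variables (which
converges for all their values) with coefficients `c_v(t_{i₀})`; and each coefficient `c_v` has on
`Ω` the asymptotic expansion `∑_k A_{v, k} t_{i₀}^k`. -/
def IsMixedExpansion {τ : Type} [Fintype τ] (i₀ : τ) (Ω : Set ℂ) (F : (τ → ℂ) → ℂ)
    (A : MvPowerSeries τ ℂ) : Prop :=
  DifferentiableOn ℂ F {t | t i₀ ∈ Ω} ∧
  ∃ c : {v : τ →₀ ℕ // v i₀ = 0} → ℂ → ℂ,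
    (∀ t : τ → ℂ, t i₀ ∈ Ω → HasSum (fun v => c v (t i₀) * ∏ i, t i ^ v.1 i) (F t)) ∧
    ∀ v, HasAsymptoticExpansion Ω (c v)
      (fun k => MvPowerSeries.coeff (v.1 + Finsupp.single i₀ k) A)

/-! ### The Hermitian matrix integral -/

/-- The space of `n × n` Hermitian matrices. -/
abbrev HermitianMatrix (n : ℕ) : Type := {X : Matrix (Fin n) (Fin n) ℂ // X.IsHermitian}

/-- The `n²` real coordinates of a Hermitian matrix: `x_ii` on the diagonal, `Re x_ij` above it
(at the position `(i, j)`, `i < j`) and `Im x_ij` below it (at the position `(j, i)`, `i < j`). -/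
def hermitianCoords (n : ℕ) : HermitianMatrix n ≃ₜ (Fin n → Fin n → ℝ) where
  toFun X i j := if i ≤ j then (X.1 i j).re else (X.1 j i).im
  invFun x := ⟨Matrix.of fun i j =>
    if i = j then (x i i : ℂ)
    else if i < j then (x i j : ℂ) + x j i * Complex.I
    else (x j i : ℂ) - x i j * Complex.I, by
      ext i j
      rcases lt_trichotomy i j with h | h | h
      · simp [Matrix.conjTranspose_apply, h, h.ne, h.ne', not_lt_of_gt h, sub_eq_add_neg]
      · subst h; simp [Matrix.conjTranspose_apply]
      · simp [Matrix.conjTranspose_apply, h, h.ne, h.ne', not_lt_of_gt h, sub_eq_add_neg]⟩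
  left_inv X := by
    have key : ∀ i j, (starRingEnd ℂ) (X.1 j i) = X.1 i j := fun i j => X.2.apply i j
    ext i j
    rcases lt_trichotomy i j with h | h | h
    · simp [h, h.ne, h.le, not_le_of_gt h, Complex.re_add_im]
    · subst h
      have := key i i
      simp [Complex.conj_eq_iff_re.1 this]
    · rw [← key i j]
      simp only [Matrix.of_apply, h.ne', if_false, not_lt_of_gt h, h.le, if_true, not_le_of_gt h]
      apply Complex.ext <;> simp
  right_inv x := by
    ext i j
    rcases lt_trichotomy i j with h | h | h
    · simp [h, h.ne, h.le]
    · subst h; simp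
    · simp [h, h.ne, not_le_of_gt h]
  continuous_toFun := by
    refine continuous_pi fun i => continuous_pi fun j => ?_
    have hc : ∀ a b, Continuous fun X : HermitianMatrix n => X.1 a b := fun a b =>
      (continuous_subtype_val).matrix_elem a b
    split_ifs
    · exact Complex.continuous_re.comp (hc i j)
    · exact Complex.continuous_im.comp (hc j i)
  continuous_invFun := by
    refine Continuous.subtype_mk (continuous_matrix fun i j => ?_) _
    simp only [Matrix.of_apply]
    split_ifs <;> fun_prop

instance (n : ℕ) : MeasurableSpace (HermitianMatrix n) := borel _

instance (n : ℕ) : BorelSpace (HermitianMatrix n) := ⟨rfl⟩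

/-- The volume form `dμ(X) = ∏ dx_ii ∏_{i<j} d(Re x_ij) d(Im x_ij)`. -/
def hermitianVolume (n : ℕ) : Measure (HermitianMatrix n) :=
  Measure.map (hermitianCoords n).symm volume

/-- The set of degrees `3, 4, …, 2m`. -/
abbrev Deg (m : ℕ) : Type := ↥(Finset.Icc 3 (2 * m))

/-- The largest degree `2m`. -/
def topDeg (m : ℕ) (hm : 2 ≤ m) : Deg m := ⟨2 * m, by simp; omega⟩

/-- The Gaussian weight `exp(-½ tr X²)`. -/
def gaussWeight {n : ℕ} (X : HermitianMatrix n) : ℂ :=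
  Complex.exp (-(1 / 2) * (X.1 ^ 2).trace)

/-- The normalization constant `N = ∫ exp(-½ tr X²) dμ(X)`. -/
def gaussNorm (n : ℕ) : ℂ := ∫ X : HermitianMatrix n, gaussWeight X ∂hermitianVolume n

/-- The integrand `exp(-½ tr X²) exp(tr ∑_{j=3}^{2m} (t_j / j) X^j)`. -/
def matrixIntegrand (n m : ℕ) (t : Deg m → ℂ) (X : HermitianMatrix n) : ℂ :=
  gaussWeight X * Complex.exp (∑ j : Deg m, (t j / (j : ℕ)) • X.1 ^ (j : ℕ)).trace

/-- The Hermitian matrix integral `Z_n(t, m)`. -/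
def matrixIntegral (n m : ℕ) (t : Deg m → ℂ) : ℂ :=
  (∫ X, matrixIntegrand n m t X ∂hermitianVolume n) / gaussNorm n

/-! ### Ribbon graphs -/

/-- A (finite) ribbon graph: a graph, given by its vertices, its half-edges and the pairing of
half-edges to edges, together with a cyclic order of the half-edges at each vertex. The graph may
be empty or disconnected, loops and multiple edges are allowed, isolated vertices are not. -/
structure RibbonGraph : Type 1 where
  V : Type
  H : Type
  finV : Finite V
  finH : Finite H
  /-- the vertex at which a half-edge sits -/
  vert : H → V
  /-- the other half of the edge -/
  edge : Equiv.Perm H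
  edge_edge : ∀ h, edge (edge h) = h
  edge_ne : ∀ h, edge h ≠ h
  /-- the next half-edge in the cyclic order at the same vertex -/
  next : Equiv.Perm H
  /-- the half-edges at each vertex form one cycle of `next` -/
  vert_eq_iff : ∀ h h', vert h = vert h' ↔ next.SameCycle h h'
  vert_surjective : Function.Surjective vert

namespace RibbonGraph

attribute [instance] finV finH

/-- The number of half-edges at a vertex. -/
def degree (Γ : RibbonGraph) (x : Γ.V) : ℕ := Nat.card {h : Γ.H // Γ.vert h = x}

/-- The number `v_j(Γ)` of vertices of degree `j`. -/
def vertexCount (Γ : RibbonGraph) (j : ℕ) : ℕ := Nat.card {x : Γ.V // Γ.degree x = j}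

/-- The number `b(Γ)` of boundary components of the fattened graph. A boundary circuit runs along
an edge from one of its half-edges `h` to the other one, `edge h`, turns at the vertex there to
the next half-edge `next (edge h)`, and so on; so the boundary circuits are the cycles (fixed
points included) of the permutation `next * edge` of the half-edges. -/
def boundaryCount (Γ : RibbonGraph) : ℕ :=
  Nat.card (Quotient (Equiv.Perm.SameCycle.setoid (Γ.next * Γ.edge)))

/-- Isomorphism of ribbon graphs. -/
def Isomorphic (Γ Γ' : RibbonGraph) : Prop :=
  ∃ (f : Γ.H ≃ Γ'.H) (g : Γ.V ≃ Γ'.V), (∀ h, Γ'.vert (f h) = g (Γ.vert h)) ∧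
    (∀ h, Γ'.edge (f h) = f (Γ.edge h)) ∧ (∀ h, Γ'.next (f h) = f (Γ.next h))

theorem Isomorphic.refl (Γ : RibbonGraph) : Γ.Isomorphic Γ :=
  ⟨Equiv.refl _, Equiv.refl _, by simp⟩

theorem Isomorphic.symm {Γ Γ' : RibbonGraph} : Γ.Isomorphic Γ' → Γ'.Isomorphic Γ := by
  rintro ⟨f, g, h1, h2, h3⟩
  refine ⟨f.symm, g.symm, fun h => ?_, fun h => ?_, fun h => ?_⟩
  · rw [Equiv.eq_symm_apply, ← h1, Equiv.apply_symm_apply]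
  · rw [Equiv.eq_symm_apply, ← h2, Equiv.apply_symm_apply]
  · rw [Equiv.eq_symm_apply, ← h3, Equiv.apply_symm_apply]

theorem Isomorphic.trans {Γ Γ' Γ'' : RibbonGraph} :
    Γ.Isomorphic Γ' → Γ'.Isomorphic Γ'' → Γ.Isomorphic Γ'' := by
  rintro ⟨f, g, h1, h2, h3⟩ ⟨f', g', h1', h2', h3'⟩
  exact ⟨f.trans f', g.trans g', by simp [*], by simp [*], by simp [*]⟩

theorem Isomorphic.boundaryCount_eq {Γ Γ' : RibbonGraph} :
    Γ.Isomorphic Γ' → Γ.boundaryCount = Γ'.boundaryCount := by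
  rintro ⟨f, g, h1, h2, h3⟩
  refine Nat.card_congr (Quotient.congr f fun a b => ?_)
  have hz : (Γ'.next * Γ'.edge) = f.permCongr (Γ.next * Γ.edge) := by
    ext x
    obtain ⟨y, rfl⟩ := f.surjective x
    simp [Equiv.permCongr_apply, h2, h3]
  change (Γ.next * Γ.edge).SameCycle a b ↔ (Γ'.next * Γ'.edge).SameCycle (f a) (f b)
  have hp : ∀ k : ℤ, (f.permCongr (Γ.next * Γ.edge)) ^ k
      = f.permCongr ((Γ.next * Γ.edge) ^ k) := fun k =>
    (map_zpow f.permCongrHom (Γ.next * Γ.edge) k).symm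
  rw [hz]
  simp only [Equiv.Perm.SameCycle, hp, Equiv.permCongr_apply, Equiv.symm_apply_apply,
    f.injective.eq_iff]

end RibbonGraph

/-- The ribbon graphs with vertices of degree `3, 4, …, 2m`, `v_j` of them of degree `j`. -/
abbrev RibbonGraphWith (m : ℕ) (v : Deg m →₀ ℕ) : Type 1 :=
  {Γ : RibbonGraph // (∀ x, Γ.degree x ∈ Finset.Icc 3 (2 * m)) ∧
    ∀ j : Deg m, Γ.vertexCount j = v j}

instance ribbonSetoid (m : ℕ) (v : Deg m →₀ ℕ) : Setoid (RibbonGraphWith m v) where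
  r Γ Γ' := Γ.1.Isomorphic Γ'.1
  iseqv := ⟨fun Γ => .refl Γ.1, .symm, .trans⟩

/-- Isomorphism classes of ribbon graphs with `v_j` vertices of degree `j`. -/
def RibbonClass (m : ℕ) (v : Deg m →₀ ℕ) : Type 1 := Quotient (ribbonSetoid m v)

/-- The number of boundary components. -/
def RibbonClass.boundaryCount {m : ℕ} {v : Deg m →₀ ℕ} : RibbonClass m v → ℕ :=
  Quotient.lift (fun Γ => Γ.1.boundaryCount) fun _ _ h => h.boundaryCount_eq

/-! ### Pairing schemes and automorphism groups -/

/-- `v_j` crossroads of degree `j` for each `j = 3, …, 2m`. -/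
abbrev Crossroads {m : ℕ} (v : Deg m →₀ ℕ) : Type := Σ j : Deg m, Fin (v j)

/-- The dots: each crossroad of degree `j` carries `j` cyclically ordered dots. -/
abbrev Dots {m : ℕ} (v : Deg m →₀ ℕ) : Type := Σ p : Crossroads v, ZMod (p.1 : ℕ)

instance {m : ℕ} (j : Deg m) : NeZero (j : ℕ) :=
  ⟨by have := Finset.mem_Icc.1 j.2; omega⟩

/-- A pairing scheme: a partition of the set of dots into pairs, given by the fixed-point free
involution that exchanges the two dots of each pair. -/
@[ext] structure PairingScheme {m : ℕ} (v : Deg m →₀ ℕ) where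
  pair : Equiv.Perm (Dots v)
  pair_pair : ∀ d, pair (pair d) = d
  pair_ne : ∀ d, pair d ≠ d

instance {m : ℕ} (v : Deg m →₀ ℕ) : Finite (PairingScheme v) :=
  Finite.of_injective PairingScheme.pair fun _ _ h => PairingScheme.ext h

/-- The group `∏_j 𝔖_{v_j} ⋉ (ℤ/j)^{v_j}`. -/
abbrev DotGroup {m : ℕ} (v : Deg m →₀ ℕ) : Type :=
  ∀ j : Deg m, (Fin (v j) → Multiplicative (ZMod (j : ℕ))) ⋊[mulAutArrow] Equiv.Perm (Fin (v j))

/-- The action of the group on the dots: an element `(a, π)` of the `j`-th factor permutes the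
crossroads of degree `j` by `π` and then rotates each crossroad `i` by `a i`. -/
def dotAction {m : ℕ} (v : Deg m →₀ ℕ) : DotGroup v →* Equiv.Perm (Dots v) :=
  MonoidHom.toHomPerm
    { toFun := fun g d => ⟨⟨d.1.1, (g d.1.1).right d.1.2⟩,
        Multiplicative.toAdd ((g d.1.1).left ((g d.1.1).right d.1.2)) + d.2⟩
      map_one' := by
        funext d
        simp [Function.End.one_def]
      map_mul' := fun g g' => by
        funext d
        obtain ⟨⟨j, i⟩, z⟩ := d
        have hr : (g j * g' j).right = (g j).right * (g' j).right := rfl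
        have hl : ∀ i, (g j * g' j).left i = (g j).left i * (g' j).left ((g j).right⁻¹ i) :=
          fun i => rfl
        change Sigma.mk _ _ = Sigma.mk _ _
        simp only [Pi.mul_apply]
        rw [hr, hl]
        simp [add_assoc] }

/-- The action of the group on pairing schemes: `d, d'` are paired in `P` if and only if
`g d, g d'` are paired in `g • P`. -/
instance {m : ℕ} (v : Deg m →₀ ℕ) : MulAction (DotGroup v) (PairingScheme v) where
  smul g P :=
    { pair := dotAction v g * P.pair * (dotAction v g)⁻¹
      pair_pair := fun d => by simp [P.pair_pair]
      pair_ne := fun d h => P.pair_ne ((dotAction v g)⁻¹ d) (by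
        rw [Equiv.Perm.eq_inv_iff_eq]; simpa using h) }
  one_smul P := PairingScheme.ext (by
    change dotAction v 1 * P.pair * (dotAction v 1)⁻¹ = P.pair
    simp)
  mul_smul g g' P := PairingScheme.ext (by
    change dotAction v (g * g') * P.pair * (dotAction v (g * g'))⁻¹
      = dotAction v g * (dotAction v g' * P.pair * (dotAction v g')⁻¹) * (dotAction v g)⁻¹
    simp [mul_assoc])

/-- Rotation of all crossroads by one step. -/
def dotNext {m : ℕ} (v : Deg m →₀ ℕ) : Equiv.Perm (Dots v) :=
  Equiv.sigmaCongrRight fun _ => Equiv.addRight 1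

theorem dotNext_apply {m : ℕ} (v : Deg m →₀ ℕ) (p : Crossroads v) (z : ZMod (p.1 : ℕ)) :
    dotNext v ⟨p, z⟩ = ⟨p, z + 1⟩ := rfl

theorem dotNext_pow {m : ℕ} (v : Deg m →₀ ℕ) (p : Crossroads v) (z : ZMod (p.1 : ℕ)) (k : ℕ) :
    (dotNext v ^ k) ⟨p, z⟩ = ⟨p, z + k⟩ := by
  induction k with
  | zero => simp
  | succ k ih => rw [pow_succ', Equiv.Perm.mul_apply, ih, dotNext_apply]; simp [add_assoc]

/-- The ribbon graph of a pairing scheme: the crossroads are the vertices, and the pairs of dots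
are the edges. -/
def PairingScheme.toRibbonGraph {m : ℕ} {v : Deg m →₀ ℕ} (P : PairingScheme v) : RibbonGraph where
  V := Crossroads v
  H := Dots v
  finV := inferInstance
  finH := inferInstance
  vert := Sigma.fst
  edge := P.pair
  edge_edge := P.pair_pair
  edge_ne := P.pair_ne
  next := dotNext v
  vert_eq_iff := by
    rintro ⟨p, z⟩ ⟨q, w⟩
    constructor
    · rintro (rfl : p = q)
      refine ⟨((w - z).val : ℕ), ?_⟩
      rw [zpow_natCast, dotNext_pow]
      simp
    · intro h
      obtain ⟨k, hk⟩ := h.exists_nat_pow_eq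
      rw [dotNext_pow] at hk
      exact (Sigma.mk.inj_iff.1 hk).1
  vert_surjective p := ⟨⟨p, 0⟩, rfl⟩

theorem PairingScheme.degree_toRibbonGraph {m : ℕ} {v : Deg m →₀ ℕ} (P : PairingScheme v)
    (p : Crossroads v) : P.toRibbonGraph.degree p = p.1 := by
  have e : {h : Dots v // h.1 = p} ≃ ZMod (p.1 : ℕ) := Equiv.sigmaSubtype p
  exact (Nat.card_congr e).trans (Nat.card_zmod _)

/-- The ribbon graph of a pairing scheme has `v_j` vertices of degree `j`. -/
def PairingScheme.toRibbonGraphWith {m : ℕ} {v : Deg m →₀ ℕ} (P : PairingScheme v) :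
    RibbonGraphWith m v :=
  ⟨P.toRibbonGraph, fun p => by rw [P.degree_toRibbonGraph p]; exact p.1.2, fun j => by
    have e1 : {p : Crossroads v // P.toRibbonGraph.degree p = (j : ℕ)}
        ≃ {p : Crossroads v // p.1 = j} :=
      Equiv.subtypeEquivRight fun p => by rw [P.degree_toRibbonGraph p, Subtype.ext_iff]
    exact (Nat.card_congr (e1.trans (Equiv.sigmaSubtype j))).trans (Nat.card_fin _)⟩

/-- The isomorphism class of ribbon graphs to which a pairing scheme corresponds. -/
def PairingScheme.toClass {m : ℕ} {v : Deg m →₀ ℕ} (P : PairingScheme v) : RibbonClass m v :=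
  Quotient.mk _ P.toRibbonGraphWith

/-- The half-edges at a vertex of degree `j` can be numbered by `ℤ/j` in their cyclic order. -/
theorem RibbonGraph.exists_numbering (Γ : RibbonGraph) (x : Γ.V) (j : ℕ) (hj : Γ.degree x = j) :
    ∃ φ : ZMod j ≃ {h : Γ.H // Γ.vert h = x}, ∀ z, (φ (z + 1)).1 = Γ.next (φ z).1 := by
  obtain ⟨b, hb⟩ := Γ.vert_surjective x
  have hmem : ∀ h, h ∈ MulAction.orbit (Subgroup.zpowers Γ.next) b ↔ Γ.vert h = x := by
    intro h
    rw [← hb, eq_comm, Γ.vert_eq_iff]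
    constructor
    · rintro ⟨⟨_, k, rfl⟩, hk⟩
      exact ⟨k, hk⟩
    · rintro ⟨k, hk⟩
      exact ⟨⟨_, k, rfl⟩, hk⟩
  let e := MulAction.orbitZPowersEquiv Γ.next b
  let e' : MulAction.orbit (Subgroup.zpowers Γ.next) b ≃ {h : Γ.H // Γ.vert h = x} :=
    Equiv.subtypeEquivRight hmem
  have hp : Function.minimalPeriod (Γ.next • ·) b = j := by
    rw [← hj, RibbonGraph.degree, ← Nat.card_congr (e.symm.trans e'), Nat.card_zmod]
  subst hp
  refine ⟨e.symm.trans e', fun z => ?_⟩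
  obtain ⟨k, rfl⟩ := ZMod.intCast_surjective z
  have h1 := MulAction.orbitZPowersEquiv_symm_apply' Γ.next b k
  have h2 := MulAction.orbitZPowersEquiv_symm_apply' Γ.next b (k + 1)
  push_cast at h2
  change (e.symm (k + 1)).1 = Γ.next (e.symm k).1
  rw [h1, h2, add_comm, zpow_add, mul_smul]
  rfl

/-- Every ribbon graph corresponds to a pairing scheme. -/
theorem PairingScheme.toClass_surjective {m : ℕ} {v : Deg m →₀ ℕ} :
    Function.Surjective (PairingScheme.toClass (v := v)) := by
  intro c
  induction c using Quotient.inductionOn with | h Γ => ?_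
  obtain ⟨Γ, hdeg, hcount⟩ := Γ
  let d : Γ.V → Deg m := fun x => ⟨Γ.degree x, hdeg x⟩
  have hfib : ∀ j : Deg m, Nonempty ({x : Γ.V // d x = j} ≃ Fin (v j)) := fun j => by
    have e : {x : Γ.V // d x = j} ≃ {x : Γ.V // Γ.degree x = (j : ℕ)} :=
      Equiv.subtypeEquivRight fun x => Subtype.ext_iff
    exact ⟨Finite.equivFinOfCardEq ((Nat.card_congr e).trans (hcount j))⟩
  let eF := fun j => (hfib j).some
  let eV : Γ.V ≃ Crossroads v := (Equiv.sigmaFiberEquiv d).symm.trans (Equiv.sigmaCongrRight eF)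
  have heV : ∀ x, (eV x).1 = d x := fun x => rfl
  have hd : ∀ p : Crossroads v, Γ.degree (eV.symm p) = (p.1 : ℕ) := fun p => by
    have := heV (eV.symm p)
    rw [Equiv.apply_symm_apply] at this
    rw [this]
  choose φ hφ using fun p : Crossroads v => Γ.exists_numbering (eV.symm p) _ (hd p)
  let f₀ : Dots v → Γ.H := fun q => (φ q.1 q.2).1
  have hf₀ : ∀ q, Γ.vert (f₀ q) = eV.symm q.1 := fun q => (φ q.1 q.2).2
  have hbij : Function.Bijective f₀ := by
    constructor
    · rintro ⟨p, z⟩ ⟨q, w⟩ h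
      have hpq : p = q := by
        have := congrArg Γ.vert h
        rw [hf₀, hf₀] at this
        exact eV.symm.injective this
      subst hpq
      have : z = w := (φ p).injective (Subtype.ext h)
      rw [this]
    · intro h
      refine ⟨⟨eV (Γ.vert h), (φ _).symm ⟨h, by simp⟩⟩, ?_⟩
      simp [f₀]
  let f : Dots v ≃ Γ.H := Equiv.ofBijective f₀ hbij
  let P : PairingScheme v :=
    { pair := f.symm.permCongr Γ.edge
      pair_pair := fun q => by simp [Equiv.permCongr_apply, Γ.edge_edge]
      pair_ne := fun q h => Γ.edge_ne (f q) (by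
        simpa [Equiv.permCongr_apply, Equiv.symm_apply_eq] using h) }
  have hP : ∀ q : Dots v, Γ.edge (f q) = f (P.pair q) := fun q => by
    simp [P, Equiv.permCongr_apply]
  exact ⟨P, Quotient.sound ⟨f, eV.symm, hf₀, hP, fun q => (hφ q.1 q.2).symm⟩⟩

instance {m : ℕ} (v : Deg m →₀ ℕ) : Finite (RibbonClass m v) :=
  Finite.of_surjective _ PairingScheme.toClass_surjective

instance {m : ℕ} (v : Deg m →₀ ℕ) : Fintype (RibbonClass m v) := Fintype.ofFinite _

/-- A pairing scheme that corresponds to the given ribbon graph. -/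
def RibbonClass.scheme {m : ℕ} {v : Deg m →₀ ℕ} (Γ : RibbonClass m v) : PairingScheme v :=
  (PairingScheme.toClass_surjective Γ).choose

/-- The automorphism group of a ribbon graph: the isotropy group of a corresponding pairing
scheme (unique up to conjugation, since the schemes of isomorphic ribbon graphs form one orbit). -/
def RibbonClass.Aut {m : ℕ} {v : Deg m →₀ ℕ} (Γ : RibbonClass m v) : Subgroup (DotGroup v) :=
  MulAction.stabilizer (DotGroup v) Γ.scheme

/-- The formal power series `∑_Γ |Aut Γ|⁻¹ n^{b(Γ)} ∏_j t_j^{v_j(Γ)}` over all ribbon graphs (up to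
isomorphism) with vertices of degree `3, …, 2m`, with coefficients in the ring `ℚ[n]`. -/
def ribbonSeries (m : ℕ) : MvPowerSeries (Deg m) ℚ[X] := fun v =>
  ∑ Γ : RibbonClass m v, C (1 / (Nat.card Γ.Aut : ℚ)) * X ^ Γ.boundaryCount

end

/-!
# The ribbon graph expansion of the Hermitian matrix integral

Write `w_j(X) = tr X^j / j`, so that the integrand is the Gaussian weight times `exp (∑ t_j w_j)`.

*Analysis.* In terms of the eigenvalues `λ_i` of `X`, `tr X^{2m} = ∑ λ_i^{2m}` dominates every
`|tr X^j|` with `j < 2m` up to an additive constant (`exists_norm_trace_pow_le`). Hence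
`exp (∑ t_j w_j)` is bounded, uniformly for `t` in a bounded set on which `Re t_{2m} ≤ -c` for
some `c > 0` (`exists_norm_exp_le`). All integrands are therefore the Gaussian
weight times a function of polynomial growth, and are integrable (`PolyGrowth.integrable`). The
dominated convergence theorem gives holomorphy (`differentiableAt_integral_exp`) and allows the
exponential of the terms with `j < 2m` to be expanded under the integral sign
(`hasSum_expansionCoeff`). In the remaining variable `z = t_{2m}`, the Taylor remainder of `exp` is
bounded in the left half plane by a power of its argument, with no exponential factor, and this
gives the asymptotic expansion of the coefficients, whose terms are the Gaussian expectations of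
`∏ w_j^{v_j} / v_j!` (`exists_norm_integral_exp_sub_sum_le`).

*Wick's theorem.* Integration by parts against the Gaussian weight in the direction of a Hermitian
matrix `V` replaces a factor `tr (V X)` by the derivative in the direction `V`; this extends complex
linearly to all matrices `V`, and elementary matrices give a recursion for the expectations of
products of matrix elements (`integral_entry_mul_prod`). The sum over the perfect matchings of the
factors satisfies the same recursion (`sum_matchings`), so the two agree (`integral_prod_entry`).

*Combinatorics.* `∏ (tr X^j)^{v_j}` is the sum, over all labellings `i` of the dots by matrix
indices, of the product of the elements `X_{i(d), i(next d)}`. A matching `σ` contributes exactly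
for the labellings that are constant on the cycles of `next ∘ σ`, i.e. `n` to the number of boundary
components times, so the expectation is a sum over pairing schemes (`integral_prod_trace_pow`). The
pairing schemes of one ribbon graph form an orbit of a group of order `∏ v_j! j^{v_j}`
(`toClass_eq_iff`, `card_dotGroup`), and the orbit-stabilizer theorem turns the sum over pairing
schemes into the sum over ribbon graphs weighted by `1 / |Aut Γ|` (`sum_ribbonClass_eq`).
-/

noncomputable section

/-! ### The sector -/

theorem re_neg_of_mem_sector {ε : ℝ} (hε : 0 < ε) {z : ℂ} (hz : z ∈ sector ε) : z.re < 0 := by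
  obtain ⟨r, θ, hr, h1, h2, rfl⟩ := hz
  rw [Complex.re_ofReal_mul, Complex.exp_ofReal_mul_I_re]
  exact mul_neg_of_pos_of_neg hr
    (Real.cos_neg_of_pi_div_two_lt_of_lt (by linarith) (by linarith))

/-- The sector is described by the principal argument of `-z`, which is continuous there. -/
theorem sector_eq {ε : ℝ} (hε : 0 < ε) :
    sector ε = {z : ℂ | -z ∈ Complex.slitPlane ∧ |Complex.arg (-z)| < Real.pi / 2 - ε} := by
  have hpi := Real.pi_pos
  ext z
  constructor
  · rintro ⟨r, θ, hr, h1, h2, rfl⟩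
    have key : -((r : ℂ) * Complex.exp (θ * Complex.I))
        = r * (Complex.cos ((θ - Real.pi : ℝ)) + Complex.sin ((θ - Real.pi : ℝ)) * Complex.I) := by
      rw [← Complex.exp_mul_I]
      push_cast
      rw [sub_mul, Complex.exp_sub, Complex.exp_pi_mul_I]
      ring
    have harg : Complex.arg (-((r : ℂ) * Complex.exp (θ * Complex.I))) = θ - Real.pi := by
      rw [key]
      exact Complex.arg_mul_cos_add_sin_mul_I hr ⟨by linarith, by linarith⟩
    have habs : |Complex.arg (-((r : ℂ) * Complex.exp (θ * Complex.I)))| < Real.pi / 2 - ε := by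
      rw [harg, abs_lt]; constructor <;> linarith
    refine ⟨?_, habs⟩
    rw [Complex.mem_slitPlane_iff_arg]
    refine ⟨fun h => ?_, ?_⟩
    · rw [h, abs_of_pos hpi] at habs; linarith
    · simp [hr.ne']
  · rintro ⟨h1, h2⟩
    rw [abs_lt] at h2
    have h0 : -z ≠ 0 := Complex.slitPlane_ne_zero h1
    refine ⟨‖-z‖, Complex.arg (-z) + Real.pi, norm_pos_iff.2 h0, by linarith, by linarith, ?_⟩
    push_cast
    rw [add_mul, Complex.exp_add, Complex.exp_pi_mul_I, ← mul_assoc,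
      Complex.norm_mul_exp_arg_mul_I]
    ring

theorem isOpen_sector {ε : ℝ} (hε : 0 < ε) : IsOpen (sector ε) := by
  rw [sector_eq hε]
  have hc : ContinuousOn (fun z : ℂ => |Complex.arg (-z)|) {z | -z ∈ Complex.slitPlane} :=
    fun z hz => ((Complex.continuousAt_arg hz).comp_of_eq continuousAt_neg rfl).abs
      |>.continuousWithinAt
  exact hc.isOpen_inter_preimage (Complex.isOpen_slitPlane.preimage continuous_neg) isOpen_Iio

theorem isPreconnected_sector (ε : ℝ) : IsPreconnected (sector ε) := by
  have h : sector ε = (fun p : ℝ × ℝ => (p.1 : ℂ) * Complex.exp (p.2 * Complex.I)) ''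
      (Set.Ioi 0 ×ˢ Set.Ioo (Real.pi / 2 + ε) (3 * Real.pi / 2 - ε)) := by
    ext z
    constructor
    · rintro ⟨r, θ, hr, h1, h2, rfl⟩
      exact ⟨(r, θ), ⟨hr, h1, h2⟩, rfl⟩
    · rintro ⟨⟨r, θ⟩, ⟨hr, h1, h2⟩, rfl⟩
      exact ⟨r, θ, hr, h1, h2, rfl⟩
  rw [h]
  exact (isPreconnected_Ioi.prod isPreconnected_Ioo).image _ (by fun_prop)

theorem zero_mem_frontier_sector {ε : ℝ} (hε : 0 < ε) (hε' : ε < Real.pi / 2) :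
    (0 : ℂ) ∈ frontier (sector ε) := by
  rw [(isOpen_sector hε).frontier_eq]
  refine ⟨?_, fun h => by simpa using re_neg_of_mem_sector hε h⟩
  have ht : Tendsto (fun r : ℝ => (r : ℂ) * Complex.exp (Real.pi * Complex.I)) (𝓝[>] 0) (𝓝 0) := by
    have : Continuous (fun r : ℝ => (r : ℂ) * Complex.exp (Real.pi * Complex.I)) := by fun_prop
    exact (this.tendsto' 0 0 (by simp)).mono_left nhdsWithin_le_nhds
  refine mem_closure_of_tendsto ht ?_
  filter_upwards [self_mem_nhdsWithin] with r hr
  exact ⟨r, Real.pi, hr, by linarith, by linarith, rfl⟩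

/-! ### Functions of polynomial growth and Gaussian integrability -/

/-- The squared Frobenius norm of a Hermitian matrix, i.e. `tr X²`. -/
def frobeniusSq {n : ℕ} (X : HermitianMatrix n) : ℝ := ∑ i, ∑ j, ‖X.1 i j‖ ^ 2

theorem frobeniusSq_nonneg {n : ℕ} (X : HermitianMatrix n) : 0 ≤ frobeniusSq X := by
  unfold frobeniusSq; positivity

/-- For Hermitian matrices, `tr X² = ∑ |x_ij|²`. -/
theorem trace_sq_eq {n : ℕ} (X : HermitianMatrix n) : (X.1 ^ 2).trace = frobeniusSq X := by
  simp only [frobeniusSq, pow_two X.1, Matrix.trace, Matrix.diag, Matrix.mul_apply]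
  push_cast
  refine Finset.sum_congr rfl fun i _ => Finset.sum_congr rfl fun j _ => ?_
  rw [← X.2.apply j i]
  exact Complex.mul_conj' _

theorem gaussWeight_eq {n : ℕ} (X : HermitianMatrix n) :
    gaussWeight X = (Real.exp (-(1 / 2) * frobeniusSq X) : ℝ) := by
  rw [gaussWeight, trace_sq_eq]; push_cast; rfl

theorem continuous_entry {n : ℕ} (i j : Fin n) : Continuous fun X : HermitianMatrix n => X.1 i j :=
  continuous_subtype_val.matrix_elem i j

theorem continuous_frobeniusSq {n : ℕ} : Continuous (frobeniusSq (n := n)) := by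
  unfold frobeniusSq
  exact continuous_finsetSum _ fun i _ => continuous_finsetSum _ fun j _ =>
    (continuous_entry i j).norm.pow 2

theorem continuous_gaussWeight {n : ℕ} : Continuous (gaussWeight (n := n)) := by
  have : gaussWeight (n := n) = fun X => ((Real.exp (-(1 / 2) * frobeniusSq X) : ℝ) : ℂ) :=
    funext gaussWeight_eq
  rw [this]
  exact Complex.continuous_ofReal.comp (Real.continuous_exp.comp
    (continuous_const.mul continuous_frobeniusSq))

theorem sum_coords_sq_le {n : ℕ} (X : HermitianMatrix n) :
    ∑ i, ∑ j, hermitianCoords n X i j ^ 2 ≤ frobeniusSq X := by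
  refine Finset.sum_le_sum fun i _ => Finset.sum_le_sum fun j _ => ?_
  change (if i ≤ j then (X.1 i j).re else (X.1 j i).im) ^ 2 ≤ _
  have hs : ‖X.1 j i‖ = ‖X.1 i j‖ := by rw [← X.2.apply j i, norm_star]
  split_ifs
  · exact sq_le_sq.2 (by simpa using Complex.abs_re_le_norm (X.1 i j))
  · exact sq_le_sq.2 (by simpa [hs] using Complex.abs_im_le_norm (X.1 j i))

theorem integral_hermitianVolume {n : ℕ} (f : HermitianMatrix n → ℂ) :
    ∫ X, f X ∂hermitianVolume n = ∫ x, f ((hermitianCoords n).symm x) := by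
  exact (hermitianCoords n).symm.measurableEmbedding.integral_map f

theorem integrable_hermitianVolume_iff {n : ℕ} {E : Type*} [NormedAddCommGroup E]
    (f : HermitianMatrix n → E) :
    Integrable f (hermitianVolume n) ↔ Integrable (fun x => f ((hermitianCoords n).symm x)) :=
  (hermitianCoords n).symm.measurableEmbedding.integrable_map_iff

theorem integrable_prod_apply (n : ℕ) {E : Type*} [MeasureSpace E]
    [SigmaFinite (volume : Measure E)] {g : E → ℝ} (hg : Integrable g) :
    Integrable (fun x : Fin n → E => ∏ i, g (x i)) :=
  Integrable.fintype_prod (ι := Fin n) (E := E) (f := fun _ => g) (μ := fun _ => volume)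
    fun _ => hg

theorem integrable_exp_neg_frobeniusSq (n : ℕ) {a : ℝ} (ha : 0 < a) :
    Integrable (fun X : HermitianMatrix n => Real.exp (-a * frobeniusSq X))
      (hermitianVolume n) := by
  rw [integrable_hermitianVolume_iff]
  have h1 := integrable_prod_apply n (integrable_prod_apply n (integrable_exp_neg_mul_sq ha))
  refine h1.mono' ?_ (ae_of_all _ fun x => ?_)
  · exact (Real.continuous_exp.comp (continuous_const.mul (continuous_frobeniusSq.comp
      (hermitianCoords n).symm.continuous))).aestronglyMeasurable
  · rw [Real.norm_of_nonneg (Real.exp_pos _).le]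
    simp only [← Real.exp_sum, ← Finset.mul_sum]
    have := sum_coords_sq_le ((hermitianCoords n).symm x)
    rw [Homeomorph.apply_symm_apply] at this
    exact Real.exp_le_exp.2 (by nlinarith)

/-- Continuous functions on the space of Hermitian matrices bounded by a constant multiple of a
power of `1 + tr X²`. -/
structure PolyGrowth {n : ℕ} (f : HermitianMatrix n → ℂ) : Prop where
  continuous : Continuous f
  bound : ∃ (C : ℝ) (k : ℕ), ∀ X, ‖f X‖ ≤ C * (1 + frobeniusSq X) ^ k

namespace PolyGrowth

variable {n : ℕ} {f g : HermitianMatrix n → ℂ}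

theorem exists_nonneg_bound (hf : PolyGrowth f) :
    ∃ (C : ℝ) (k : ℕ), 0 ≤ C ∧ ∀ X, ‖f X‖ ≤ C * (1 + frobeniusSq X) ^ k := by
  obtain ⟨C, k, h⟩ := hf.bound
  refine ⟨max C 0, k, le_max_right _ _, fun X => (h X).trans ?_⟩
  have := frobeniusSq_nonneg X
  gcongr
  exact le_max_left _ _

theorem of_bounded (hf : Continuous f) (K : ℝ) (h : ∀ X, ‖f X‖ ≤ K) : PolyGrowth f :=
  ⟨hf, K, 0, by simpa using h⟩

theorem const (c : ℂ) : PolyGrowth (fun _ : HermitianMatrix n => c) :=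
  of_bounded continuous_const ‖c‖ fun _ => le_rfl

theorem entry (i j : Fin n) : PolyGrowth (fun X : HermitianMatrix n => X.1 i j) := by
  refine ⟨continuous_entry i j, 1, 1, fun X => ?_⟩
  have h : ‖X.1 i j‖ ^ 2 ≤ frobeniusSq X :=
    (Finset.single_le_sum (f := fun j => ‖X.1 i j‖ ^ 2) (fun _ _ => by positivity)
      (Finset.mem_univ j)).trans
    (Finset.single_le_sum (f := fun i => ∑ j, ‖X.1 i j‖ ^ 2) (fun _ _ => by positivity)
      (Finset.mem_univ i))
  nlinarith [sq_nonneg (‖X.1 i j‖ - 1)]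

theorem add (hf : PolyGrowth f) (hg : PolyGrowth g) : PolyGrowth (fun X => f X + g X) := by
  obtain ⟨C, k, hC, h⟩ := hf.exists_nonneg_bound
  obtain ⟨D, l, hD, h'⟩ := hg.exists_nonneg_bound
  refine ⟨hf.continuous.add hg.continuous, C + D, k + l, fun X => ?_⟩
  have hq : 1 ≤ 1 + frobeniusSq X := by linarith [frobeniusSq_nonneg X]
  calc ‖f X + g X‖ ≤ ‖f X‖ + ‖g X‖ := norm_add_le _ _
    _ ≤ C * (1 + frobeniusSq X) ^ k + D * (1 + frobeniusSq X) ^ l := add_le_add (h X) (h' X)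
    _ ≤ C * (1 + frobeniusSq X) ^ (k + l) + D * (1 + frobeniusSq X) ^ (k + l) := by
      gcongr <;> omega
    _ = _ := by ring

theorem mul (hf : PolyGrowth f) (hg : PolyGrowth g) : PolyGrowth (fun X => f X * g X) := by
  obtain ⟨C, k, hC, h⟩ := hf.exists_nonneg_bound
  obtain ⟨D, l, hD, h'⟩ := hg.exists_nonneg_bound
  refine ⟨hf.continuous.mul hg.continuous, C * D, k + l, fun X => ?_⟩
  have hq : 0 ≤ frobeniusSq X := frobeniusSq_nonneg X
  calc ‖f X * g X‖ = ‖f X‖ * ‖g X‖ := norm_mul _ _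
    _ ≤ (C * (1 + frobeniusSq X) ^ k) * (D * (1 + frobeniusSq X) ^ l) :=
      mul_le_mul (h X) (h' X) (norm_nonneg _) (by positivity)
    _ = _ := by ring

theorem norm (hf : PolyGrowth f) : PolyGrowth (fun X => (‖f X‖ : ℂ)) :=
  ⟨Complex.continuous_ofReal.comp hf.continuous.norm, by simpa using hf.bound⟩

theorem pow (hf : PolyGrowth f) (k : ℕ) : PolyGrowth (fun X => f X ^ k) := by
  induction k with
  | zero => simpa using const 1
  | succ k ih => simpa only [pow_succ] using ih.mul hf

theorem sum {ι : Type*} (s : Finset ι) {f : ι → HermitianMatrix n → ℂ}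
    (hf : ∀ i ∈ s, PolyGrowth (f i)) : PolyGrowth (fun X => ∑ i ∈ s, f i X) := by
  classical
  induction s using Finset.induction_on with
  | empty => simpa using const 0
  | insert a s ha ih =>
    simp only [Finset.sum_insert ha]
    exact (hf a (Finset.mem_insert_self a s)).add
      (ih fun i hi => hf i (Finset.mem_insert_of_mem hi))

theorem prod {ι : Type*} (s : Finset ι) {f : ι → HermitianMatrix n → ℂ}
    (hf : ∀ i ∈ s, PolyGrowth (f i)) : PolyGrowth (fun X => ∏ i ∈ s, f i X) := by
  classical
  induction s using Finset.induction_on with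
  | empty => simpa using const 1
  | insert a s ha ih =>
    simp only [Finset.prod_insert ha]
    exact (hf a (Finset.mem_insert_self a s)).mul
      (ih fun i hi => hf i (Finset.mem_insert_of_mem hi))

theorem pow_entry (k : ℕ) (i j : Fin n) :
    PolyGrowth (fun X : HermitianMatrix n => (X.1 ^ k) i j) := by
  induction k generalizing i j with
  | zero => simpa using const _
  | succ k ih =>
    simp only [pow_succ, Matrix.mul_apply]
    exact sum _ fun l _ => (ih i l).mul (entry l j)

theorem trace_pow (k : ℕ) : PolyGrowth (fun X : HermitianMatrix n => (X.1 ^ k).trace) :=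
  sum _ fun i _ => pow_entry k i i

theorem integrable (hf : PolyGrowth f) :
    Integrable (fun X => gaussWeight X * f X) (hermitianVolume n) := by
  obtain ⟨C, k, hC, h⟩ := hf.exists_nonneg_bound
  -- Half of the Gaussian weight absorbs the polynomial, since `x ^ k / k! ≤ exp x`.
  refine ((integrable_exp_neg_frobeniusSq n (a := 1 / 4) (by norm_num)).const_mul
    (C * (4 ^ k * k.factorial * Real.exp (1 / 4)))).mono'
    (continuous_gaussWeight.mul hf.continuous).aestronglyMeasurable (ae_of_all _ fun X => ?_)
  have hq := frobeniusSq_nonneg X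
  rw [norm_mul, gaussWeight_eq, Complex.norm_real, Real.norm_of_nonneg (Real.exp_pos _).le]
  have h1 : (1 + frobeniusSq X) ^ k
      ≤ 4 ^ k * k.factorial * Real.exp ((1 + frobeniusSq X) / 4) := by
    have := Real.pow_div_factorial_le_exp ((1 + frobeniusSq X) / 4) (by positivity) k
    rw [div_le_iff₀ (by positivity), div_pow, div_le_iff₀ (by positivity)] at this
    linarith
  calc Real.exp (-(1 / 2) * frobeniusSq X) * ‖f X‖
      ≤ Real.exp (-(1 / 2) * frobeniusSq X) *
        (C * (4 ^ k * k.factorial * Real.exp ((1 + frobeniusSq X) / 4))) := by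
        gcongr
        exact (h X).trans (by gcongr)
    _ = C * (4 ^ k * k.factorial) *
        (Real.exp (-(1 / 2) * frobeniusSq X) * Real.exp ((1 + frobeniusSq X) / 4)) := by ring
    _ = C * (4 ^ k * k.factorial) * (Real.exp (1 / 4) * Real.exp (-(1 / 4) * frobeniusSq X)) := by
        rw [← Real.exp_add, ← Real.exp_add]; ring_nf
    _ = _ := by ring

end PolyGrowth

theorem gaussNorm_ne_zero (n : ℕ) : gaussNorm n ≠ 0 := by
  have h1 : gaussNorm n = ((∫ x : Fin n → Fin n → ℝ,
      Real.exp (-(1 / 2) * frobeniusSq ((hermitianCoords n).symm x)) : ℝ) : ℂ) := by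
    rw [_root_.gaussNorm, integral_hermitianVolume, ← integral_complex_ofReal]
    simp only [gaussWeight_eq]
  rw [h1]
  refine Complex.ofReal_ne_zero.2 (ne_of_gt ?_)
  exact integral_exp_pos ((integrable_hermitianVolume_iff _).1
    (integrable_exp_neg_frobeniusSq n (a := 1 / 2) (by norm_num)))

/-! ### Wick's theorem -/

/-- The Hermitian matrix with given real coordinates, as a real linear map. -/
def coordsToMatrix (n : ℕ) : (Fin n → Fin n → ℝ) →ₗ[ℝ] Matrix (Fin n) (Fin n) ℂ where
  toFun x := ((hermitianCoords n).symm x).1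
  map_add' x y := by
    ext i j
    simp only [hermitianCoords, Homeomorph.homeomorph_mk_coe_symm, Equiv.coe_fn_symm_mk,
      Matrix.of_apply, Matrix.add_apply, Pi.add_apply]
    split_ifs <;> push_cast <;> ring
  map_smul' c x := by
    ext i j
    simp only [hermitianCoords, Homeomorph.homeomorph_mk_coe_symm, Equiv.coe_fn_symm_mk,
      Matrix.of_apply, Matrix.smul_apply, Pi.smul_apply, RingHom.id_apply, Complex.real_smul,
      smul_eq_mul]
    split_ifs <;> push_cast <;> ring

theorem coordsToMatrix_apply {n : ℕ} (x : Fin n → Fin n → ℝ) :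
    ((hermitianCoords n).symm x).1 = coordsToMatrix n x := rfl

theorem hasLineDerivAt_prod_entry {n : ℕ} {D : Type*} [DecidableEq D] (S : Finset D)
    (a b : D → Fin n) (x v : Fin n → Fin n → ℝ) :
    HasLineDerivAt ℝ (fun x => ∏ d ∈ S, ((hermitianCoords n).symm x).1 (a d) (b d))
      (∑ d ∈ S, coordsToMatrix n v (a d) (b d) *
        ∏ d' ∈ S.erase d, ((hermitianCoords n).symm x).1 (a d') (b d')) x v := by
  unfold HasLineDerivAt
  simp only [coordsToMatrix_apply, map_add, map_smul, Matrix.add_apply, Matrix.smul_apply,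
    Complex.real_smul]
  have h : ∀ d ∈ S, HasDerivAt (fun t : ℝ => coordsToMatrix n x (a d) (b d)
      + (t : ℂ) * coordsToMatrix n v (a d) (b d)) (coordsToMatrix n v (a d) (b d)) 0 := by
    intro d _
    simpa using ((Complex.ofRealCLM.hasDerivAt (x := (0 : ℝ))).mul_const
      (coordsToMatrix n v (a d) (b d))).const_add (coordsToMatrix n x (a d) (b d))
  have := HasDerivAt.fun_finsetProd h
  simpa [mul_comm] using this

theorem hasLineDerivAt_gaussWeight {n : ℕ} (x v : Fin n → Fin n → ℝ) :
    HasLineDerivAt ℝ (fun x => gaussWeight ((hermitianCoords n).symm x))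
      (-(gaussWeight ((hermitianCoords n).symm x) *
        (coordsToMatrix n v * ((hermitianCoords n).symm x).1).trace)) x v := by
  unfold HasLineDerivAt gaussWeight
  simp only [coordsToMatrix_apply, map_add, map_smul]
  set A := coordsToMatrix n x
  set B := coordsToMatrix n v
  have h : ∀ t : ℝ, ((A + t • B) ^ 2).trace
      = (A ^ 2).trace + 2 * (t : ℂ) * (B * A).trace + (t : ℂ) ^ 2 * (B ^ 2).trace := by
    intro t
    simp only [pow_two, add_mul, mul_add, Matrix.trace_add, Matrix.smul_mul, Matrix.mul_smul,
      Matrix.trace_smul, Complex.real_smul, Matrix.trace_mul_comm A B]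
    ring
  simp only [h]
  have hc : HasDerivAt (fun t : ℝ => (t : ℂ)) 1 0 := Complex.ofRealCLM.hasDerivAt (x := (0 : ℝ))
  have := (((((hc.const_mul 2).mul_const (B * A).trace).const_add (A ^ 2).trace).add
    ((hc.pow 2).mul_const (B ^ 2).trace)).const_mul (-(1 / 2) : ℂ)).cexp
  refine (this.congr_deriv ?_).congr_of_eventuallyEq (.of_forall fun t => rfl)
  simp

/-- Integration by parts in the direction of a Hermitian matrix `V`: the derivative of `½ tr X²` in
this direction is `tr (V X)`. -/
theorem integral_trace_mul_prod_of_hermitian {n : ℕ} {D : Type*} [DecidableEq D] (S : Finset D)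
    (a b : D → Fin n) (V : HermitianMatrix n) :
    ∫ X, gaussWeight X * ((V.1 * X.1).trace * ∏ d ∈ S, X.1 (a d) (b d)) ∂hermitianVolume n
      = ∑ d ∈ S, V.1 (a d) (b d) *
        ∫ X, gaussWeight X * ∏ d' ∈ S.erase d, X.1 (a d') (b d') ∂hermitianVolume n := by
  have hprod : ∀ T : Finset D, PolyGrowth fun X : HermitianMatrix n => ∏ d ∈ T, X.1 (a d) (b d) :=
    fun T => PolyGrowth.prod T fun d _ => PolyGrowth.entry (a d) (b d)
  have htr : PolyGrowth fun X : HermitianMatrix n => (V.1 * X.1).trace := by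
    simp only [Matrix.trace, Matrix.diag, Matrix.mul_apply]
    exact PolyGrowth.sum _ fun i _ => PolyGrowth.sum _ fun j _ =>
      (PolyGrowth.const _).mul (PolyGrowth.entry j i)
  have hsum : PolyGrowth fun X : HermitianMatrix n =>
      ∑ d ∈ S, V.1 (a d) (b d) * ∏ d' ∈ S.erase d, X.1 (a d') (b d') :=
    PolyGrowth.sum _ fun d _ => (PolyGrowth.const _).mul (hprod _)
  obtain ⟨v, rfl⟩ := (hermitianCoords n).symm.surjective V
  have ibp := integral_bilinear_hasLineDerivAt_right_eq_neg_left_of_integrable (v := v)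
    (μ := (volume : Measure (Fin n → Fin n → ℝ))) (B := ContinuousLinearMap.mul ℝ ℂ)
    (f := fun x => gaussWeight ((hermitianCoords n).symm x))
    (f' := fun x => -(gaussWeight ((hermitianCoords n).symm x) *
        (coordsToMatrix n v * ((hermitianCoords n).symm x).1).trace))
    (g := fun x => ∏ d ∈ S, ((hermitianCoords n).symm x).1 (a d) (b d))
    (g' := fun x => ∑ d ∈ S, coordsToMatrix n v (a d) (b d) *
        ∏ d' ∈ S.erase d, ((hermitianCoords n).symm x).1 (a d') (b d'))
    (by
      have := (integrable_hermitianVolume_iff _).1 (htr.mul (hprod S)).integrable.neg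
      refine this.congr (ae_of_all _ fun x => ?_)
      simp [coordsToMatrix_apply, mul_assoc])
    ((integrable_hermitianVolume_iff _).1 hsum.integrable)
    ((integrable_hermitianVolume_iff _).1 (hprod S).integrable)
    (fun x _ => hasLineDerivAt_gaussWeight x v)
    (fun x _ => hasLineDerivAt_prod_entry S a b x v)
  simp only [ContinuousLinearMap.mul_apply', neg_mul, integral_neg, neg_neg] at ibp
  have e1 : ∀ d, ∫ X, gaussWeight X * ∏ d' ∈ S.erase d, X.1 (a d') (b d') ∂hermitianVolume n
      = ∫ x, gaussWeight ((hermitianCoords n).symm x) *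
        ∏ d' ∈ S.erase d, ((hermitianCoords n).symm x).1 (a d') (b d') :=
    fun d => integral_hermitianVolume _
  rw [integral_hermitianVolume]
  simp only [e1, ← integral_const_mul]
  rw [← integral_finsetSum]
  · simp only [coordsToMatrix_apply, mul_assoc, Finset.mul_sum] at ibp ⊢
    rw [← ibp]
    simp only [mul_left_comm]
  · exact fun d _ => ((integrable_hermitianVolume_iff _).1 (hprod _).integrable).const_mul _

/-- The Schwinger-Dyson equation for the Gaussian measure: integration by parts in the directions
of Hermitian matrices, extended complex linearly to all directions `V`. -/
theorem integral_trace_mul_prod {n : ℕ} {D : Type*} [DecidableEq D] (S : Finset D)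
    (a b : D → Fin n) (V : Matrix (Fin n) (Fin n) ℂ) :
    ∫ X, gaussWeight X * ((V * X.1).trace * ∏ d ∈ S, X.1 (a d) (b d)) ∂hermitianVolume n
      = ∑ d ∈ S, V (a d) (b d) *
        ∫ X, gaussWeight X * ∏ d' ∈ S.erase d, X.1 (a d') (b d') ∂hermitianVolume n := by
  let V₁ : HermitianMatrix n := ⟨realPart V, selfAdjoint.mem_iff.1 (realPart V).2⟩
  let V₂ : HermitianMatrix n := ⟨imaginaryPart V, selfAdjoint.mem_iff.1 (imaginaryPart V).2⟩
  have hV : V = V₁.1 + Complex.I • V₂.1 := (realPart_add_I_smul_imaginaryPart V).symm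
  have hint : ∀ W : HermitianMatrix n, Integrable (fun X : HermitianMatrix n =>
      gaussWeight X * ((W.1 * X.1).trace * ∏ d ∈ S, X.1 (a d) (b d))) (hermitianVolume n) := by
    intro W
    refine PolyGrowth.integrable (PolyGrowth.mul ?_ (PolyGrowth.prod S fun d _ =>
      PolyGrowth.entry (a d) (b d)))
    simp only [Matrix.trace, Matrix.diag, Matrix.mul_apply]
    exact PolyGrowth.sum _ fun i _ => PolyGrowth.sum _ fun j _ =>
      (PolyGrowth.const _).mul (PolyGrowth.entry j i)
  rw [hV]
  have h : ∀ X : HermitianMatrix n,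
      gaussWeight X * (((V₁.1 + Complex.I • V₂.1) * X.1).trace * ∏ d ∈ S, X.1 (a d) (b d))
      = gaussWeight X * ((V₁.1 * X.1).trace * ∏ d ∈ S, X.1 (a d) (b d)) +
        Complex.I * (gaussWeight X * ((V₂.1 * X.1).trace * ∏ d ∈ S, X.1 (a d) (b d))) := by
    intro X
    rw [add_mul, Matrix.trace_add, Matrix.smul_mul, Matrix.trace_smul, smul_eq_mul]
    ring
  simp only [h]
  rw [integral_add (hint V₁) ((hint V₂).const_mul _), integral_const_mul,
    integral_trace_mul_prod_of_hermitian, integral_trace_mul_prod_of_hermitian, Finset.mul_sum,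
    ← Finset.sum_add_distrib]
  refine Finset.sum_congr rfl fun d _ => ?_
  rw [Matrix.add_apply, Matrix.smul_apply, smul_eq_mul]
  ring

/-- The recursion behind Wick's theorem: the factor `X_ij` is contracted with each of the others,
the covariance of `X_ij` and `X_kl` being `δ_il δ_jk`. -/
theorem integral_entry_mul_prod {n : ℕ} {D : Type*} [DecidableEq D] (S : Finset D)
    (a b : D → Fin n) (i j : Fin n) :
    ∫ X, gaussWeight X * (X.1 i j * ∏ d ∈ S, X.1 (a d) (b d)) ∂hermitianVolume n
      = ∑ d ∈ S, (if i = b d then 1 else 0) * (if a d = j then 1 else 0) *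
        ∫ X, gaussWeight X * ∏ d' ∈ S.erase d, X.1 (a d') (b d') ∂hermitianVolume n := by
  have h := integral_trace_mul_prod S a b (Matrix.single j i 1)
  simp only [Matrix.trace_single_mul, one_smul] at h
  rw [h]
  refine Finset.sum_congr rfl fun d _ => ?_
  rw [Matrix.single_apply]
  by_cases h1 : i = b d <;> by_cases h2 : j = a d <;> simp [h1, h2, Ne.symm (a := j) (b := a d)]

/-- The perfect matchings of a finite set `S`, as involutions of the ambient type that move exactly
the elements of `S`. -/
def matchings {D : Type*} [Fintype D] [DecidableEq D] (S : Finset D) : Finset (Equiv.Perm D) :=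
  Finset.univ.filter fun σ => (∀ d, σ (σ d) = d) ∧ ∀ d, σ d ≠ d ↔ d ∈ S

theorem mem_matchings {D : Type*} [Fintype D] [DecidableEq D] {S : Finset D} {σ : Equiv.Perm D} :
    σ ∈ matchings S ↔ (∀ d, σ (σ d) = d) ∧ ∀ d, σ d ≠ d ↔ d ∈ S := by
  simp [matchings]

theorem matchings_empty {D : Type*} [Fintype D] [DecidableEq D] :
    matchings (∅ : Finset D) = {1} := by
  ext σ
  rw [mem_matchings, Finset.mem_singleton]
  constructor
  · rintro ⟨-, h⟩
    ext d
    simpa using h d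
  · rintro rfl
    simp

/-- A matching is determined by the partner of `d₀` and the matching of the remaining elements. -/
theorem sum_matchings {D : Type*} [Fintype D] [DecidableEq D] {R : Type*} [CommSemiring R]
    (K : D → D → R) {S : Finset D} {d₀ : D} (hd₀ : d₀ ∈ S) :
    ∑ σ ∈ matchings S, ∏ d ∈ S, K d (σ d) =
      ∑ d₁ ∈ S.erase d₀, K d₀ d₁ * K d₁ d₀ *
        ∑ τ ∈ matchings ((S.erase d₀).erase d₁), ∏ d ∈ (S.erase d₀).erase d₁, K d (τ d) := by
  simp only [Finset.mul_sum]
  rw [Finset.sum_sigma']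
  refine Finset.sum_bij' (fun σ _ => ⟨σ d₀, Equiv.swap d₀ (σ d₀) * σ⟩)
    (fun p _ => Equiv.swap d₀ p.1 * p.2) ?_ ?_ ?_ ?_ ?_
  · intro σ hσ
    obtain ⟨h1, h2⟩ := mem_matchings.1 hσ
    have hne := (h2 d₀).2 hd₀
    simp only [Finset.mem_sigma, Finset.mem_erase, mem_matchings, Equiv.Perm.mul_apply]
    refine ⟨⟨hne, (h2 _).1 fun h => hne ((h1 d₀).symm.trans h).symm⟩, ?_⟩
    have key : ∀ d, d ≠ d₀ → d ≠ σ d₀ → Equiv.swap d₀ (σ d₀) (σ d) = σ d := by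
      intro d h h'
      refine Equiv.swap_apply_of_ne_of_ne (fun e => h' ?_) (fun e => h (σ.injective e))
      rw [← e, h1]
    have key0 : Equiv.swap d₀ (σ d₀) (σ d₀) = d₀ := Equiv.swap_apply_right _ _
    have key1 : Equiv.swap d₀ (σ d₀) (σ (σ d₀)) = σ d₀ := by rw [h1, Equiv.swap_apply_left]
    constructor
    · intro d
      by_cases e0 : d = d₀
      · subst e0; rw [key0, key0]
      by_cases e1 : d = σ d₀
      · subst e1; rw [key1, key1]
      rw [key d e0 e1, key _ (fun e => e1 (by rw [← e, h1])) (fun e => e0 (σ.injective e)), h1]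
    · intro d
      by_cases e0 : d = d₀
      · subst e0; simp
      by_cases e1 : d = σ d₀
      · subst e1; simp [key1]
      rw [key d e0 e1]
      simp [e0, e1, h2]
  · rintro ⟨d₁, τ⟩ h
    simp only [Finset.mem_sigma, Finset.mem_erase, mem_matchings] at h
    obtain ⟨⟨hne, hd₁⟩, h1, h2⟩ := h
    have t0 : τ d₀ = d₀ := not_not.1 ((h2 d₀).not.2 (by simp))
    have t1 : τ d₁ = d₁ := not_not.1 ((h2 d₁).not.2 (by simp))
    have key : ∀ d, d ≠ d₀ → d ≠ d₁ → Equiv.swap d₀ d₁ (τ d) = τ d := by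
      intro d h h'
      exact Equiv.swap_apply_of_ne_of_ne (fun e => h (τ.injective (e.trans t0.symm)))
        (fun e => h' (τ.injective (e.trans t1.symm)))
    simp only [mem_matchings, Equiv.Perm.mul_apply]
    constructor
    · intro d
      by_cases e0 : d = d₀
      · subst e0; simp [t0, t1]
      by_cases e1 : d = d₁
      · subst e1; simp [t0, t1]
      rw [key d e0 e1, key _ (fun e => e0 (τ.injective (e.trans t0.symm)))
        (fun e => e1 (τ.injective (e.trans t1.symm))), h1]
    · intro d
      by_cases e0 : d = d₀
      · subst e0; simp [t0, hne, hd₀]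
      by_cases e1 : d = d₁
      · subst e1; simp [t1, hd₁, Ne.symm hne]
      rw [key d e0 e1, h2]
      simp [e0, e1]
  · intro σ _
    simp [← mul_assoc]
  · rintro ⟨d₁, τ⟩ h
    simp only [Finset.mem_sigma, Finset.mem_erase, mem_matchings] at h
    have t0 : τ d₀ = d₀ := not_not.1 ((h.2.2 d₀).not.2 (by simp))
    simp [t0, ← mul_assoc]
  · intro σ hσ
    obtain ⟨h1, h2⟩ := mem_matchings.1 hσ
    have hne := (h2 d₀).2 hd₀
    have hd₁ : σ d₀ ∈ S.erase d₀ :=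
      Finset.mem_erase.2 ⟨hne, (h2 _).1 fun h => hne ((h1 d₀).symm.trans h).symm⟩
    rw [← Finset.mul_prod_erase S _ hd₀, ← Finset.mul_prod_erase _ _ hd₁, h1, mul_assoc]
    congr 2
    refine Finset.prod_congr rfl fun d hd => ?_
    simp only [Finset.mem_erase] at hd
    rw [Equiv.Perm.mul_apply, Equiv.swap_apply_of_ne_of_ne]
    · exact fun e => hd.1 (by rw [← e, h1])
    · exact fun e => hd.2.1 (σ.injective e)

/-- Wick's theorem for products of matrix elements. The contraction of the pair `{d, d'}` is
`δ(a d, b d') δ(a d', b d)`, so each element of `S` carries one of the two factors of its pair. -/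
theorem integral_prod_entry {n : ℕ} {D : Type*} [Fintype D] [DecidableEq D] (a b : D → Fin n)
    (S : Finset D) :
    ∫ X, gaussWeight X * ∏ d ∈ S, X.1 (a d) (b d) ∂hermitianVolume n
      = _root_.gaussNorm n *
        ∑ σ ∈ matchings S, ∏ d ∈ S, if a d = b (σ d) then (1 : ℂ) else 0 := by
  induction S using Finset.strongInduction with
  | H S ih =>
  obtain rfl | ⟨d₀, hd₀⟩ := S.eq_empty_or_nonempty
  · simp [matchings_empty, _root_.gaussNorm]
  · rw [sum_matchings (fun d d' => if a d = b d' then (1 : ℂ) else 0) hd₀]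
    simp only [← Finset.mul_prod_erase S _ hd₀]
    rw [integral_entry_mul_prod, Finset.mul_sum]
    refine Finset.sum_congr rfl fun d₁ hd₁ => ?_
    rw [ih _ ((Finset.erase_ssubset hd₁).trans (Finset.erase_ssubset hd₀))]
    ring

/-! ### Traces of powers as sums over the labellings of the dots -/

/-- An element of a matrix power as a sum over paths, summed over the end points with weight `g`. -/
theorem sum_prod_chain {R ι : Type*} [CommRing R] [Fintype ι] [DecidableEq ι] (A : Matrix ι ι R)
    (k : ℕ) (g : ι → ι → R) :
    ∑ i : Fin (k + 1) → ι, (∏ l : Fin k, A (i l.castSucc) (i l.succ)) * g (i 0) (i (Fin.last k))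
      = ∑ a, ∑ b, (A ^ k) a b * g a b := by
  induction k generalizing g with
  | zero =>
    rw [← (Equiv.funUnique (Fin 1) ι).symm.sum_comp]
    simp [Matrix.one_apply]
  | succ k ih =>
    rw [← (Fin.consEquiv fun _ => ι).sum_comp, Fintype.sum_prod_type]
    refine Finset.sum_congr rfl fun a _ => ?_
    have h := ih fun c b => A a c * g a b
    simp only [Fin.consEquiv_apply, Fin.prod_univ_succ, Fin.castSucc_zero, Fin.cons_zero,
      Fin.cons_succ, Fin.castSucc_succ, ← Fin.succ_last] at h ⊢
    rw [pow_succ']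
    simp only [Matrix.mul_apply, Finset.sum_mul]
    rw [Finset.sum_comm]
    refine (Finset.sum_congr rfl fun i _ => ?_).trans (h.trans ?_)
    · ring
    · exact Finset.sum_congr rfl fun c _ => Finset.sum_congr rfl fun b _ => by ring

/-- The trace of a power as a sum over closed paths. -/
theorem trace_pow_eq_sum {R ι : Type*} [CommRing R] [Fintype ι] [DecidableEq ι] (A : Matrix ι ι R)
    (j : ℕ) [NeZero j] :
    (A ^ j).trace = ∑ i : ZMod j → ι, ∏ z, A (i z) (i (z + 1)) := by
  obtain ⟨k, rfl⟩ := Nat.exists_eq_succ_of_ne_zero (NeZero.ne j)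
  have h := sum_prod_chain A k fun a b => A b a
  rw [Matrix.trace, pow_succ]
  simp only [Matrix.diag, Matrix.mul_apply]
  rw [← h]
  change _ = ∑ i : Fin (k + 1) → ι, ∏ z : Fin (k + 1), A (i z) (i (z + 1))
  simp only [Fin.prod_univ_castSucc, Fin.coeSucc_eq_succ, Fin.last_add_one]

theorem prod_trace_pow_eq_sum {m n : ℕ} (v : Deg m →₀ ℕ) (A : Matrix (Fin n) (Fin n) ℂ) :
    ∏ j : Deg m, (A ^ (j : ℕ)).trace ^ v j
      = ∑ i : Dots v → Fin n, ∏ d, A (i d) (i (dotNext v d)) := by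
  have h1 : ∏ j : Deg m, (A ^ (j : ℕ)).trace ^ v j
      = ∏ p : Crossroads v, (A ^ (p.1 : ℕ)).trace := by
    rw [Fintype.prod_sigma]
    simp
  rw [h1]
  simp only [trace_pow_eq_sum]
  rw [Finset.prod_univ_sum, Fintype.piFinset_univ,
    ← (Equiv.piCurry fun (_ : Crossroads v) (_ : ZMod _) => Fin n).sum_comp]
  refine Finset.sum_congr rfl fun i _ => ?_
  exact (Fintype.prod_sigma fun d : Dots v => A (i d) (i (dotNext v d))).symm

/-- The labellings that are invariant under a permutation are the functions on its cycles. -/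
theorem sum_prod_ite_eq_pow {D : Type*} [Fintype D] [DecidableEq D] (n : ℕ) (π : Equiv.Perm D) :
    ∑ i : D → Fin n, ∏ d, (if i d = i (π d) then (1 : ℂ) else 0)
      = (n : ℂ) ^ Nat.card (Quotient (Equiv.Perm.SameCycle.setoid π)) := by
  classical
  have hinv : ∀ (i : D → Fin n), (∀ d, i d = i (π d)) → ∀ (d d' : D), π.SameCycle d d' →
      i d = i d' := by
    rintro i hi d d' hs
    obtain ⟨k, rfl⟩ := hs.exists_nat_pow_eq
    induction k with
    | zero => rfl
    | succ k ih =>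
      rw [pow_succ', Equiv.Perm.mul_apply, ← hi]
      exact ih ⟨k, by simp⟩
  let e : {i : D → Fin n // ∀ d, i d = i (π d)}
      ≃ (Quotient (Equiv.Perm.SameCycle.setoid π) → Fin n) :=
    { toFun := fun i => Quotient.lift i.1 fun d d' h => hinv i.1 i.2 d d' h
      invFun := fun f => ⟨fun d => f (Quotient.mk _ d), fun d =>
        congrArg f (Quotient.sound ⟨1, by simp⟩)⟩
      left_inv := fun i => rfl
      right_inv := fun f => by
        funext q
        induction q using Quotient.inductionOn with | h d => rfl }
  simp only [Fintype.prod_boole]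
  rw [Finset.sum_boole, ← Fintype.card_subtype, ← Nat.card_eq_fintype_card, Nat.card_congr e,
    Nat.card_fun, Nat.card_fin]
  push_cast
  rfl

instance {m : ℕ} (v : Deg m →₀ ℕ) : Fintype (PairingScheme v) := Fintype.ofFinite _

theorem sum_matchings_univ {m : ℕ} (v : Deg m →₀ ℕ) (f : Equiv.Perm (Dots v) → ℂ) :
    ∑ σ ∈ matchings (Finset.univ : Finset (Dots v)), f σ = ∑ P : PairingScheme v, f P.pair := by
  refine Finset.sum_bij' (fun σ hσ => (⟨σ, (mem_matchings.1 hσ).1,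
    fun d => ((mem_matchings.1 hσ).2 d).2 (Finset.mem_univ d)⟩ : PairingScheme v))
    (fun P _ => P.pair) ?_ ?_ ?_ ?_ ?_
  · exact fun _ _ => Finset.mem_univ _
  · exact fun P _ => mem_matchings.2 ⟨P.pair_pair, fun d => by simp [P.pair_ne d]⟩
  · exact fun _ _ => rfl
  · exact fun _ _ => rfl
  · exact fun _ _ => rfl

/-- The Gaussian expectation of a product of traces counts the pairing schemes, weighted by
`n` to the power of the number of boundary components. -/
theorem integral_prod_trace_pow {m n : ℕ} (v : Deg m →₀ ℕ) :
    ∫ X, gaussWeight X * ∏ j : Deg m, (X.1 ^ (j : ℕ)).trace ^ v j ∂hermitianVolume n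
      = _root_.gaussNorm n * ∑ P : PairingScheme v, (n : ℂ) ^ P.toRibbonGraph.boundaryCount := by
  simp only [prod_trace_pow_eq_sum, Finset.mul_sum]
  rw [integral_finsetSum]
  · simp only [integral_prod_entry]
    rw [← Finset.mul_sum, Finset.sum_comm, ← Finset.mul_sum]
    congr 1
    rw [sum_matchings_univ v fun σ => ∑ i : Dots v → Fin n,
      ∏ d, if i d = i (dotNext v (σ d)) then (1 : ℂ) else 0]
    refine Finset.sum_congr rfl fun P _ => ?_
    exact sum_prod_ite_eq_pow n (dotNext v * P.pair)
  · exact fun i _ => (PolyGrowth.prod _ fun d _ => PolyGrowth.entry _ _).integrable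

/-! ### Automorphisms and orbits of pairing schemes -/

theorem dotAction_apply {m : ℕ} {v : Deg m →₀ ℕ} (g : DotGroup v) (j : Deg m) (i : Fin (v j))
    (z : ZMod (j : ℕ)) : dotAction v g ⟨⟨j, i⟩, z⟩
      = ⟨⟨j, (g j).right i⟩, Multiplicative.toAdd ((g j).left ((g j).right i)) + z⟩ := rfl

theorem dotAction_dotNext {m : ℕ} {v : Deg m →₀ ℕ} (g : DotGroup v) (d : Dots v) :
    dotAction v g (dotNext v d) = dotNext v (dotAction v g d) := by
  obtain ⟨⟨j, i⟩, z⟩ := d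
  rw [dotNext_apply, dotAction_apply, dotAction_apply, dotNext_apply, add_assoc]

/-- Every permutation of the dots which respects the cyclic orders comes from the group. -/
theorem exists_dotAction_eq {m : ℕ} {v : Deg m →₀ ℕ} (f : Equiv.Perm (Dots v))
    (hf : ∀ d, f (dotNext v d) = dotNext v (f d)) : ∃ g : DotGroup v, dotAction v g = f := by
  have hpow : ∀ (d : Dots v) (k : ℕ), f ((dotNext v ^ k) d) = (dotNext v ^ k) (f d) := by
    intro d k
    induction k with
    | zero => rfl
    | succ k ih => rw [pow_succ', Equiv.Perm.mul_apply, hf, ih, Equiv.Perm.mul_apply]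
  -- Following the cyclic order, a crossroad goes to a crossroad, of the same degree since the two
  -- have the same period.
  have hex : ∀ (j : Deg m) (i : Fin (v j)), ∃ (i' : Fin (v j)) (a : ZMod (j : ℕ)),
      ∀ z, f ⟨⟨j, i⟩, z⟩ = ⟨⟨j, i'⟩, a + z⟩ := by
    intro j i
    obtain ⟨⟨⟨j', i'⟩, a⟩, h0⟩ : ∃ d, f ⟨⟨j, i⟩, 0⟩ = d := ⟨_, rfl⟩
    have hk : ∀ k : ℕ, f ⟨⟨j, i⟩, (k : ZMod (j : ℕ))⟩ = ⟨⟨j', i'⟩, a + k⟩ := by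
      intro k
      have := hpow ⟨⟨j, i⟩, 0⟩ k
      rwa [h0, dotNext_pow, dotNext_pow, zero_add] at this
    have hjj : j = j' := by
      apply Subtype.ext
      apply Nat.dvd_antisymm
      · have h1 := hk (j' : ℕ)
        rw [ZMod.natCast_self, add_zero, ← h0, f.apply_eq_iff_eq] at h1
        rw [← ZMod.natCast_eq_zero_iff]
        simpa using h1
      · have h1 := hk (j : ℕ)
        rw [ZMod.natCast_self, h0] at h1
        rw [← ZMod.natCast_eq_zero_iff]
        simpa using h1
    subst hjj
    refine ⟨i', a, fun z => ?_⟩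
    have := hk z.val
    rwa [ZMod.natCast_zmod_val] at this
  choose r a hr using hex
  have hinj : ∀ j, Function.Injective (r j) := by
    intro j i₁ i₂ h
    have : f ⟨⟨j, i₁⟩, -a j i₁⟩ = f ⟨⟨j, i₂⟩, -a j i₂⟩ := by
      rw [hr, hr, h, add_neg_cancel, add_neg_cancel]
    have := f.injective this
    simp only [Sigma.mk.injEq, heq_eq_eq, true_and] at this
    simpa using this.1
  let π : ∀ j, Equiv.Perm (Fin (v j)) := fun j =>
    Equiv.ofBijective (r j) (Finite.injective_iff_bijective.1 (hinj j))
  refine ⟨fun j => ⟨fun i => Multiplicative.ofAdd (a j ((π j).symm i)), π j⟩, ?_⟩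
  ext ⟨⟨j, i⟩, z⟩ : 1
  rw [dotAction_apply, hr]
  change (⟨⟨j, π j i⟩, a j ((π j).symm (π j i)) + z⟩ : Dots v) = _
  rw [Equiv.symm_apply_apply]
  rfl

theorem pair_smul {m : ℕ} {v : Deg m →₀ ℕ} (g : DotGroup v) (P : PairingScheme v) :
    (g • P).pair = dotAction v g * P.pair * (dotAction v g)⁻¹ := rfl

/-- Two pairing schemes define isomorphic ribbon graphs if and only if they lie in one orbit. -/
theorem toClass_eq_iff {m : ℕ} {v : Deg m →₀ ℕ} (P Q : PairingScheme v) :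
    P.toClass = Q.toClass ↔ P ∈ MulAction.orbit (DotGroup v) Q := by
  rw [eq_comm]
  constructor
  · intro h
    obtain ⟨f, -, -, h2, h3⟩ : Q.toRibbonGraph.Isomorphic P.toRibbonGraph := Quotient.exact h
    obtain ⟨g, hg⟩ := exists_dotAction_eq (v := v) f fun d => (h3 d).symm
    refine ⟨g, PairingScheme.ext ?_⟩
    have h2' : ∀ d, P.pair (dotAction v g d) = dotAction v g (Q.pair d) := by rw [hg]; exact h2
    exact mul_inv_eq_of_eq_mul (Equiv.ext fun d => (h2' d).symm)
  · rintro ⟨g, rfl⟩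
    refine Quotient.sound ⟨dotAction v g,
      Equiv.sigmaCongrRight fun j => (g j).right, ?_, ?_, ?_⟩
    · rintro ⟨⟨j, i⟩, z⟩
      rfl
    · intro (d : Dots v)
      change (g • Q).pair (dotAction v g d) = dotAction v g (Q.pair d)
      simp [pair_smul]
    · exact fun d => (dotAction_dotNext g d).symm

theorem card_dotGroup {m : ℕ} (v : Deg m →₀ ℕ) :
    Nat.card (DotGroup v) = ∏ j : Deg m, (v j).factorial * (j : ℕ) ^ v j := by
  rw [Nat.card_pi]
  refine Finset.prod_congr rfl fun j _ => ?_
  rw [SemidirectProduct.card, Nat.card_fun, Nat.card_perm, Nat.card_fin, mul_comm]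
  congr 2
  exact Nat.card_zmod _

theorem card_dotGroup_ne_zero {m : ℕ} (v : Deg m →₀ ℕ) : Nat.card (DotGroup v) ≠ 0 := by
  rw [card_dotGroup]
  exact Finset.prod_ne_zero_iff.2 fun j _ =>
    mul_ne_zero (Nat.factorial_ne_zero _) (pow_ne_zero _ (NeZero.ne _))

theorem card_toClass_fiber_mul_card_aut {m : ℕ} {v : Deg m →₀ ℕ} (Γ : RibbonClass m v) :
    Nat.card {P : PairingScheme v // P.toClass = Γ} * Nat.card Γ.Aut = Nat.card (DotGroup v) := by
  have hΓ : Γ.scheme.toClass = Γ := (PairingScheme.toClass_surjective Γ).choose_spec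
  have h : Nat.card {P : PairingScheme v // P.toClass = Γ}
      = Nat.card (MulAction.orbit (DotGroup v) Γ.scheme) :=
    Nat.card_congr (Equiv.subtypeEquivRight fun P => by rw [← toClass_eq_iff, hΓ])
  rw [h, ← Subgroup.card_mul_index Γ.Aut, mul_comm, RibbonClass.Aut, MulAction.index_stabilizer]
  rfl

/-- The sum over the ribbon graphs is the sum over the pairing schemes, divided by the order of the
group. -/
theorem sum_ribbonClass_eq {m : ℕ} (v : Deg m →₀ ℕ) (n : ℕ) :
    ∑ Γ : RibbonClass m v, 1 / (Nat.card Γ.Aut : ℂ) * (n : ℂ) ^ Γ.boundaryCount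
      = (∑ P : PairingScheme v, (n : ℂ) ^ P.toRibbonGraph.boundaryCount)
        / ∏ j : Deg m, ((v j).factorial * (j : ℂ) ^ v j) := by
  classical
  have hG : ∏ j : Deg m, (((v j).factorial : ℂ) * (j : ℂ) ^ v j) = Nat.card (DotGroup v) := by
    rw [card_dotGroup]; push_cast; rfl
  have h0 : (Nat.card (DotGroup v) : ℂ) ≠ 0 := Nat.cast_ne_zero.2 (card_dotGroup_ne_zero v)
  rw [hG, ← Finset.sum_fiberwise Finset.univ PairingScheme.toClass, Finset.sum_div]
  refine Finset.sum_congr rfl fun Γ _ => ?_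
  have h1 : ∑ P : PairingScheme v with P.toClass = Γ, (n : ℂ) ^ P.toRibbonGraph.boundaryCount
      = Nat.card {P : PairingScheme v // P.toClass = Γ} * (n : ℂ) ^ Γ.boundaryCount := by
    rw [Nat.card_eq_fintype_card, Fintype.card_subtype, ← nsmul_eq_mul]
    refine Finset.sum_eq_card_nsmul fun P hP => ?_
    rw [← (Finset.mem_filter.1 hP).2]
    rfl
  have h2 := card_toClass_fiber_mul_card_aut Γ
  have h3 : (Nat.card Γ.Aut : ℂ) ≠ 0 :=
    Nat.cast_ne_zero.2 fun h => card_dotGroup_ne_zero v (by rw [← h2, h, mul_zero])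
  rw [h1, ← h2]
  push_cast
  rw [← h2] at h0
  push_cast at h0
  have h4 := left_ne_zero_of_mul h0
  field_simp

theorem coeff_ribbonSeries {m : ℕ} (v : Deg m →₀ ℕ) (n : ℕ) :
    MvPowerSeries.coeff v (MvPowerSeries.map
      (Polynomial.eval₂RingHom (algebraMap ℚ ℂ) (n : ℂ)) (ribbonSeries m))
      = (∑ P : PairingScheme v, (n : ℂ) ^ P.toRibbonGraph.boundaryCount)
        / ∏ j : Deg m, ((v j).factorial * (j : ℂ) ^ v j) := by
  rw [← sum_ribbonClass_eq, MvPowerSeries.coeff_map]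
  change Polynomial.eval₂RingHom (algebraMap ℚ ℂ) (n : ℂ)
    (∑ Γ : RibbonClass m v, C (1 / (Nat.card Γ.Aut : ℚ)) * X ^ Γ.boundaryCount) = _
  rw [map_sum]
  refine Finset.sum_congr rfl fun Γ _ => ?_
  simp

/-! ### Exponential series -/

theorem hasSum_mul {ι κ : Type*} {f : ι → ℂ} {g : κ → ℂ} {a b : ℂ} (hf : HasSum f a)
    (hg : HasSum g b) : HasSum (fun p : ι × κ => f p.1 * g p.2) (a * b) :=
  hf.mul hg (summable_mul_of_summable_norm hf.summable.norm hg.summable.norm)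

theorem hasSum_fin_pi_prod (k : ℕ) (f : Fin k → ℕ → ℂ) (a : Fin k → ℂ)
    (h : ∀ i, HasSum (f i) (a i)) :
    HasSum (fun v : Fin k → ℕ => ∏ i, f i (v i)) (∏ i, a i) := by
  induction k with
  | zero => simp
  | succ k ih =>
    rw [← (Fin.consEquiv fun _ => ℕ).hasSum_iff, Fin.prod_univ_succ]
    have h0 := h 0
    have h1 := ih (fun i => f i.succ) (fun i => a i.succ) fun i => h i.succ
    have h2 := hasSum_mul h0 h1
    have h3 : (fun v : Fin (k + 1) → ℕ => ∏ i, f i (v i)) ∘ (Fin.consEquiv fun _ => ℕ)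
        = fun p => f 0 p.1 * ∏ i : Fin k, f i.succ (p.2 i) := by
      funext p
      simp [Fin.consEquiv, Fin.prod_univ_succ]
    rw [h3]
    exact h2

theorem hasSum_pi_prod {ι : Type*} [Fintype ι] (f : ι → ℕ → ℂ) (a : ι → ℂ)
    (h : ∀ i, HasSum (f i) (a i)) :
    HasSum (fun v : ι → ℕ => ∏ i, f i (v i)) (∏ i, a i) := by
  let e := Fintype.equivFin ι
  have := hasSum_fin_pi_prod _ (fun i => f (e.symm i)) (fun i => a (e.symm i)) fun i => h _
  rw [e.symm.prod_comp a, ← (Equiv.arrowCongr e (Equiv.refl ℕ)).hasSum_iff] at this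
  convert this using 1
  funext v
  rw [← e.symm.prod_comp fun i => f i (v i)]
  rfl

/-- The exponential series in several variables. -/
theorem hasSum_prod_pow_div_factorial {τ : Type*} [Fintype τ] [DecidableEq τ] (i₀ : τ)
    (y : τ → ℂ) :
    HasSum (fun v : {v : τ →₀ ℕ // v i₀ = 0} => ∏ j, y j ^ v.1 j / (v.1 j).factorial)
      (Complex.exp (∑ j ∈ Finset.univ.erase i₀, y j)) := by
  -- Only the constant term is kept in the variable `i₀`.
  let f : τ → ℕ → ℂ := fun j k => if j = i₀ then (if k = 0 then 1 else 0) else y j ^ k / k.factorial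
  let a : τ → ℂ := fun j => if j = i₀ then 1 else Complex.exp (y j)
  have h1 : HasSum (fun v : τ → ℕ => ∏ j, f j (v j)) (∏ j, a j) := by
    refine hasSum_pi_prod f a fun j => ?_
    by_cases hj : j = i₀
    · simpa [f, a, hj] using hasSum_ite_eq (0 : ℕ) (1 : ℂ)
    · simpa [f, a, hj, Complex.exp_eq_exp_ℂ] using NormedSpace.expSeries_div_hasSum_exp (y j)
  have ha : ∏ j, a j = Complex.exp (∑ j ∈ Finset.univ.erase i₀, y j) := by
    rw [Complex.exp_sum, ← Finset.mul_prod_erase _ _ (Finset.mem_univ i₀)]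
    simp only [a, if_true, one_mul]
    exact Finset.prod_congr rfl fun j hj => if_neg (Finset.ne_of_mem_erase hj)
  rw [ha, ← (Finsupp.equivFunOnFinite : (τ →₀ ℕ) ≃ (τ → ℕ)).hasSum_iff] at h1
  have h2 := (hasSum_subtype_iff_of_support_subset (s := {v : τ →₀ ℕ | v i₀ = 0}) ?_).2 h1
  · have h3 : (fun v : {v : τ →₀ ℕ // v i₀ = 0} => ∏ j, y j ^ v.1 j / (v.1 j).factorial)
        = fun v => ∏ j, f j (v.1 j) := by
      funext v
      refine Finset.prod_congr rfl fun j _ => ?_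
      have hv : v.1 i₀ = 0 := v.2
      by_cases hj : j = i₀
      · subst hj; simp [f, hv]
      · simp [f, hj]
    rw [h3]
    exact h2
  · intro v hv
    by_contra hne
    refine hv (Finset.prod_eq_zero (Finset.mem_univ i₀) ?_)
    have : v i₀ ≠ 0 := hne
    simp [f, this]

/-- Taylor's formula for the exponential function in the left half plane, where its derivatives
are bounded by `1`. -/
theorem norm_exp_sub_sum_le_of_re_nonpos (N : ℕ) {y : ℂ} (hy : y.re ≤ 0) :
    ‖Complex.exp y - ∑ k ∈ Finset.range N, y ^ k / k.factorial‖ ≤ ‖y‖ ^ N := by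
  induction N generalizing y with
  | zero => simpa [Complex.norm_exp] using hy
  | succ N ih =>
    have hd : ∀ x : ℂ, HasDerivAt
        (fun y : ℂ => Complex.exp y - ∑ k ∈ Finset.range (N + 1), y ^ k / (k.factorial : ℂ))
        (Complex.exp x - ∑ k ∈ Finset.range N, x ^ k / (k.factorial : ℂ)) x := by
      intro x
      simp only [Finset.sum_range_succ', pow_zero]
      have h1 : ∀ k ∈ Finset.range N, HasDerivAt
          (fun y : ℂ => y ^ (k + 1) / ((k + 1).factorial : ℂ)) (x ^ k / (k.factorial : ℂ)) x := by
        intro k _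
        refine ((hasDerivAt_pow (k + 1) x).div_const ((k + 1).factorial : ℂ)).congr_deriv ?_
        rw [Nat.factorial_succ, Nat.add_sub_cancel]
        push_cast
        have : (k.factorial : ℂ) ≠ 0 := Nat.cast_ne_zero.2 k.factorial_ne_zero
        have : (k : ℂ) + 1 ≠ 0 := Nat.cast_add_one_ne_zero k
        field_simp
      exact (Complex.hasDerivAt_exp x).sub ((HasDerivAt.fun_sum h1).add_const _)
    have hseg : ∀ x ∈ segment ℝ 0 y, x.re ≤ 0 ∧ ‖x‖ ≤ ‖y‖ := by
      rintro x ⟨a, b, ha, hb, hab, rfl⟩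
      rw [smul_zero, zero_add]
      refine ⟨?_, ?_⟩
      · rw [Complex.real_smul, Complex.re_ofReal_mul]; exact mul_nonpos_of_nonneg_of_nonpos hb hy
      · rw [norm_smul, Real.norm_of_nonneg hb]
        exact mul_le_of_le_one_left (norm_nonneg _) (by linarith)
    have := Convex.norm_image_sub_le_of_norm_hasDerivWithin_le (𝕜 := ℂ) (s := segment ℝ 0 y)
      (C := ‖y‖ ^ N) (fun x _ => (hd x).hasDerivWithinAt)
      (fun x hx => (ih (hseg x hx).1).trans (by gcongr; exact (hseg x hx).2))
      (convex_segment 0 y)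
      (left_mem_segment ℝ 0 y) (right_mem_segment ℝ 0 y)
    simpa [Finset.sum_range_succ', pow_succ] using this

/-! ### Bounds for the integrand -/

theorem trace_pow_eq_sum_eigenvalues {n : ℕ} (X : HermitianMatrix n) (k : ℕ) :
    (X.1 ^ k).trace = ((∑ i, X.2.eigenvalues i ^ k : ℝ) : ℂ) := by
  conv_lhs => rw [X.2.spectral_theorem]
  rw [← map_pow, Unitary.conjStarAlgAut_apply, Matrix.trace_mul_cycle, Unitary.coe_star_mul_self,
    one_mul, Matrix.diagonal_pow, Matrix.trace_diagonal]
  simp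

/-- A lower power is dominated by an arbitrarily small multiple of a higher one, up to a constant. -/
theorem exists_abs_pow_le {j k : ℕ} (hjk : j < k) {δ : ℝ} (hδ : 0 < δ) :
    ∃ C : ℝ, 0 ≤ C ∧ ∀ x : ℝ, |x| ^ j ≤ δ * |x| ^ k + C := by
  refine ⟨max 1 δ⁻¹ ^ j, by positivity, fun x => ?_⟩
  rcases le_total |x| (max 1 δ⁻¹) with h | h
  · have : |x| ^ j ≤ max 1 δ⁻¹ ^ j := by gcongr
    have : 0 ≤ δ * |x| ^ k := by positivity
    linarith
  · have h1 : 1 ≤ |x| := (le_max_left _ _).trans h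
    have h2 : 1 ≤ δ * |x| := by
      have := (le_max_right 1 δ⁻¹).trans h
      rwa [inv_le_iff_one_le_mul₀' hδ] at this
    have h3 : |x| ^ (j + 1) ≤ |x| ^ k := pow_le_pow_right₀ h1 hjk
    have h4 : 0 ≤ max 1 δ⁻¹ ^ j := by positivity
    calc |x| ^ j ≤ |x| ^ j * (δ * |x|) := le_mul_of_one_le_right (by positivity) h2
      _ = δ * |x| ^ (j + 1) := by ring
      _ ≤ δ * |x| ^ k + max 1 δ⁻¹ ^ j := by nlinarith

/-- By diagonalization, `tr X^{2m}` dominates the traces of all the lower powers. -/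
theorem exists_norm_trace_pow_le (n : ℕ) {j m : ℕ} (hj : j < 2 * m) {δ : ℝ} (hδ : 0 < δ) :
    ∃ C : ℝ, 0 ≤ C ∧ ∀ X : HermitianMatrix n,
      ‖(X.1 ^ j).trace‖ ≤ δ * ((X.1 ^ (2 * m)).trace).re + C := by
  obtain ⟨C, hC, h⟩ := exists_abs_pow_le hj hδ
  refine ⟨n * C, by positivity, fun X => ?_⟩
  rw [trace_pow_eq_sum_eigenvalues, trace_pow_eq_sum_eigenvalues, Complex.norm_real,
    Complex.ofReal_re]
  calc ‖∑ i, X.2.eigenvalues i ^ j‖ ≤ ∑ i, ‖X.2.eigenvalues i ^ j‖ := norm_sum_le _ _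
    _ ≤ ∑ i, (δ * X.2.eigenvalues i ^ (2 * m) + C) := by
      refine Finset.sum_le_sum fun i _ => ?_
      rw [norm_pow, Real.norm_eq_abs]
      refine (h _).trans_eq ?_
      rw [pow_mul, sq_abs, ← pow_mul]
    _ = _ := by simp [Finset.sum_add_distrib, Finset.mul_sum]

/-- The function `tr X^j / j` multiplying `t_j` in the exponent. -/
def tracePotential {n : ℕ} (j : ℕ) (X : HermitianMatrix n) : ℂ := (X.1 ^ j).trace / j

theorem polyGrowth_tracePotential {n : ℕ} (j : ℕ) :
    PolyGrowth (tracePotential (n := n) j) := by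
  have h := (PolyGrowth.trace_pow (n := n) j).mul (PolyGrowth.const (j : ℂ)⁻¹)
  simp only [← div_eq_mul_inv] at h
  exact h

theorem matrixIntegrand_eq {n m : ℕ} (t : Deg m → ℂ) (X : HermitianMatrix n) :
    matrixIntegrand n m t X
      = gaussWeight X * Complex.exp (∑ j : Deg m, t j * tracePotential j X) := by
  rw [matrixIntegrand, Matrix.trace_sum]
  congr 3
  funext j
  rw [Matrix.trace_smul, smul_eq_mul, tracePotential]
  ring

theorem tracePotential_two_mul {n : ℕ} (m : ℕ) (X : HermitianMatrix n) :
    ∃ r : ℝ, 0 ≤ r ∧ tracePotential (2 * m) X = r := by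
  refine ⟨(∑ i, X.2.eigenvalues i ^ (2 * m)) / (2 * m : ℕ), div_nonneg
    (Finset.sum_nonneg fun i _ => (even_two_mul m).pow_nonneg _) (Nat.cast_nonneg _), ?_⟩
  rw [tracePotential, trace_pow_eq_sum_eigenvalues]
  push_cast
  rfl

theorem tracePotential_topDeg {n m : ℕ} (hm : 2 ≤ m) (X : HermitianMatrix n) :
    ∃ r : ℝ, 0 ≤ r ∧ tracePotential (topDeg m hm : ℕ) X = r := tracePotential_two_mul m X

/-- The top degree term dominates all the other ones. -/
theorem exists_sum_norm_tracePotential_le (n : ℕ) {m : ℕ} (hm : 2 ≤ m) {c A : ℝ} (hc : 0 < c)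
    (hA : 0 ≤ A) : ∃ K : ℝ, ∀ X : HermitianMatrix n,
      ∑ j ∈ Finset.univ.erase (topDeg m hm), A * ‖tracePotential (j : ℕ) X‖
        ≤ c * (tracePotential (topDeg m hm : ℕ) X).re + K := by
  set s := Finset.univ.erase (topDeg m hm)
  have hm0 : (0 : ℝ) < (2 * m : ℕ) := by exact_mod_cast (by omega : 0 < 2 * m)
  -- Each of the `s.card` terms, multiplied by `A`, may use up at most the fraction `1 / s.card` of
  -- `c * tr X^{2m} / (2m)`; the summand `1` only avoids a division by zero.
  set δ : ℝ := c / ((2 * m : ℕ) * (A * s.card + 1)) with hδ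
  have hδ0 : 0 < δ := by positivity
  have hlt : ∀ j ∈ s, (j : ℕ) < 2 * m := by
    intro j hj
    have h1 := (Finset.mem_Icc.1 j.2).2
    have h2 : (j : ℕ) ≠ 2 * m := fun h => Finset.ne_of_mem_erase hj (Subtype.ext h)
    omega
  have h : ∀ j : Deg m, ∃ C : ℝ, j ∈ s → ∀ X : HermitianMatrix n,
      ‖(X.1 ^ (j : ℕ)).trace‖ ≤ δ * ((X.1 ^ (2 * m)).trace).re + C := by
    intro j
    by_cases hj : j ∈ s
    · obtain ⟨C, -, hC⟩ := exists_norm_trace_pow_le n (hlt j hj) hδ0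
      exact ⟨C, fun _ => hC⟩
    · exact ⟨0, fun h => absurd h hj⟩
  choose C hC using h
  refine ⟨∑ j ∈ s, A * C j, fun X => ?_⟩
  obtain ⟨r, hr, hr'⟩ := tracePotential_two_mul m X
  have hT : ((X.1 ^ (2 * m)).trace).re = (2 * m : ℕ) * r := by
    have h1 : (X.1 ^ (2 * m)).trace = (2 * m : ℕ) * tracePotential (2 * m) X := by
      rw [tracePotential, mul_div_cancel₀]
      exact_mod_cast hm0.ne'
    rw [h1, hr', ← Complex.ofReal_natCast, ← Complex.ofReal_mul, Complex.ofReal_re]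
  have htop : (tracePotential (topDeg m hm : ℕ) X).re = r := by
    change (tracePotential (2 * m) X).re = r
    rw [hr', Complex.ofReal_re]
  rw [htop]
  calc ∑ j ∈ s, A * ‖tracePotential (j : ℕ) X‖
      ≤ ∑ j ∈ s, (A * (δ * ((2 * m : ℕ) * r)) + A * C j) := by
        refine Finset.sum_le_sum fun j hj => ?_
        rw [← mul_add]
        gcongr
        rw [← hT]
        refine le_trans ?_ (hC j hj X)
        rw [tracePotential, norm_div, Complex.norm_natCast]
        refine div_le_self (norm_nonneg _) ?_
        exact_mod_cast (by have := (Finset.mem_Icc.1 j.2).1; omega : 1 ≤ (j : ℕ))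
    _ = (A * s.card) * (δ * (2 * m : ℕ)) * r + ∑ j ∈ s, A * C j := by
        rw [Finset.sum_add_distrib, Finset.sum_const, nsmul_eq_mul]; ring
    _ ≤ (A * s.card + 1) * (δ * (2 * m : ℕ)) * r + ∑ j ∈ s, A * C j := by
        gcongr; linarith
    _ = c * r + ∑ j ∈ s, A * C j := by
        congr 2
        rw [hδ]
        field_simp

/-- The exponential factor of the integrand is bounded, locally uniformly in `t`. -/
theorem exists_norm_exp_le (n : ℕ) {m : ℕ} (hm : 2 ≤ m) {c A : ℝ} (hc : 0 < c) (hA : 0 ≤ A) :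
    ∃ K : ℝ, ∀ t : Deg m → ℂ, (t (topDeg m hm)).re ≤ -c → ‖t‖ ≤ A → ∀ X : HermitianMatrix n,
      ‖Complex.exp (∑ j : Deg m, t j * tracePotential (j : ℕ) X)‖ ≤ K := by
  obtain ⟨K, hK⟩ := exists_sum_norm_tracePotential_le n hm hc hA
  refine ⟨Real.exp K, fun t ht htA X => ?_⟩
  rw [Complex.norm_exp, Real.exp_le_exp, ← Finset.add_sum_erase _ _ (Finset.mem_univ (topDeg m hm)),
    Complex.add_re, Complex.re_sum]
  have h1 := hK X
  obtain ⟨r, hr, hr'⟩ := tracePotential_topDeg hm X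
  rw [hr', Complex.ofReal_re] at h1
  rw [hr', Complex.re_mul_ofReal]
  have h2 : ∑ j ∈ Finset.univ.erase (topDeg m hm), (t j * tracePotential (j : ℕ) X).re
      ≤ ∑ j ∈ Finset.univ.erase (topDeg m hm), A * ‖tracePotential (j : ℕ) X‖ := by
    refine Finset.sum_le_sum fun j _ => (Complex.re_le_norm _).trans ?_
    rw [norm_mul]
    gcongr
    exact (norm_le_pi_norm t j).trans htA
  nlinarith

theorem continuous_exp_tracePotential {n m : ℕ} (t : Deg m → ℂ) :
    Continuous fun X : HermitianMatrix n =>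
      Complex.exp (∑ j : Deg m, t j * tracePotential (j : ℕ) X) :=
  Complex.continuous_exp.comp (continuous_finsetSum _ fun _ _ =>
    continuous_const.mul (polyGrowth_tracePotential _).continuous)

theorem polyGrowth_exp {n m : ℕ} (hm : 2 ≤ m) {t : Deg m → ℂ} (ht : (t (topDeg m hm)).re < 0) :
    PolyGrowth fun X : HermitianMatrix n =>
      Complex.exp (∑ j : Deg m, t j * tracePotential (j : ℕ) X) := by
  obtain ⟨K, hK⟩ := exists_norm_exp_le n hm (neg_pos.2 ht) (norm_nonneg t)
  exact PolyGrowth.of_bounded (continuous_exp_tracePotential t) K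
    (hK t (by linarith) le_rfl)

/-! ### Holomorphy of the integrals -/

/-- The linear form `t ↦ tr ∑_j t_j X^j / j`. -/
def potentialForm {n m : ℕ} (X : HermitianMatrix n) : (Deg m → ℂ) →L[ℂ] ℂ :=
  ∑ j : Deg m, tracePotential (j : ℕ) X • ContinuousLinearMap.proj (R := ℂ) j

theorem continuous_potentialForm {n m : ℕ} : Continuous (potentialForm (n := n) (m := m)) :=
  continuous_finsetSum _ fun _ _ =>
    (polyGrowth_tracePotential _).continuous.smul continuous_const

theorem norm_potentialForm_le {n m : ℕ} (X : HermitianMatrix n) :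
    ‖potentialForm (m := m) X‖ ≤ ∑ j : Deg m, ‖tracePotential (j : ℕ) X‖ := by
  refine (norm_sum_le _ _).trans (Finset.sum_le_sum fun j _ => ?_)
  rw [norm_smul]
  refine mul_le_of_le_one_right (norm_nonneg _) ?_
  exact ContinuousLinearMap.opNorm_le_bound _ zero_le_one fun t => by
    simpa using norm_le_pi_norm t j

theorem hasFDerivAt_exp_potential {n m : ℕ} (X : HermitianMatrix n) (t : Deg m → ℂ) :
    HasFDerivAt (fun t : Deg m → ℂ => Complex.exp (∑ j : Deg m, t j * tracePotential (j : ℕ) X))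
      (Complex.exp (∑ j : Deg m, t j * tracePotential (j : ℕ) X) • potentialForm X) t := by
  have h : (fun t : Deg m → ℂ => ∑ j : Deg m, t j * tracePotential (j : ℕ) X)
      = potentialForm (m := m) X := by
    funext t
    simp [potentialForm, mul_comm]
  have h1 : HasFDerivAt (fun t : Deg m → ℂ => ∑ j : Deg m, t j * tracePotential (j : ℕ) X)
      (potentialForm X) t := by
    rw [h]
    exact (potentialForm X).hasFDerivAt
  exact h1.cexp

/-- Differentiation under the integral sign, with the bound of `exists_norm_exp_le` near `t₀`. -/
theorem differentiableAt_integral_exp {n m : ℕ} (hm : 2 ≤ m) {g : HermitianMatrix n → ℂ}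
    (hg : PolyGrowth g) {t₀ : Deg m → ℂ} (ht₀ : (t₀ (topDeg m hm)).re < 0) :
    DifferentiableAt ℂ (fun t : Deg m → ℂ => ∫ X, gaussWeight X *
      (g X * Complex.exp (∑ j : Deg m, t j * tracePotential (j : ℕ) X)) ∂hermitianVolume n) t₀ := by
  set c : ℝ := -(t₀ (topDeg m hm)).re / 2 with hc
  have hc0 : 0 < c := by rw [hc]; linarith
  obtain ⟨K, hK⟩ := exists_norm_exp_le n hm hc0 (A := ‖t₀‖ + 1) (by positivity)
  let s : Set (Deg m → ℂ) := {t | (t (topDeg m hm)).re < -c ∧ ‖t‖ < ‖t₀‖ + 1}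
  have hs : s ∈ 𝓝 t₀ := by
    have h1 : Continuous fun t : Deg m → ℂ => (t (topDeg m hm)).re := by fun_prop
    exact (h1.continuousAt.eventually_lt continuousAt_const (by rw [hc]; linarith)).and
      (continuous_norm.continuousAt.eventually_lt continuousAt_const (by linarith))
  have hcont : ∀ t : Deg m → ℂ, Continuous fun X : HermitianMatrix n => gaussWeight X *
      (g X * Complex.exp (∑ j : Deg m, t j * tracePotential (j : ℕ) X)) := fun t =>
    continuous_gaussWeight.mul (hg.continuous.mul (continuous_exp_tracePotential t))
  have hbound : PolyGrowth fun X : HermitianMatrix n =>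
      (‖g X‖ : ℂ) * ((K : ℂ) * ∑ j : Deg m, (‖tracePotential (j : ℕ) X‖ : ℂ)) :=
    hg.norm.mul ((PolyGrowth.const _).mul
      (PolyGrowth.sum _ fun j _ => (polyGrowth_tracePotential _).norm))
  refine (hasFDerivAt_integral_of_dominated_of_fderiv_le (𝕜 := ℂ) (s := s)
    (F' := fun t X => (gaussWeight X *
      (g X * Complex.exp (∑ j : Deg m, t j * tracePotential (j : ℕ) X))) •
      potentialForm X)
    (bound := fun X => ‖gaussWeight X *
      ((‖g X‖ : ℂ) * ((K : ℂ) * ∑ j : Deg m, (‖tracePotential (j : ℕ) X‖ : ℂ)))‖)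
    hs ?_ ?_ ?_ ?_ ?_ ?_).differentiableAt
  · exact .of_forall fun t => (hcont t).aestronglyMeasurable
  · exact (hg.mul (polyGrowth_exp hm ht₀)).integrable
  · exact ((hcont t₀).smul continuous_potentialForm).aestronglyMeasurable
  · refine ae_of_all _ fun X t ht => ?_
    have hE := hK t ht.1.le ht.2.le X
    have hK0 : 0 ≤ K := (norm_nonneg _).trans hE
    have hS := norm_potentialForm_le (m := m) X
    have hsum : ‖∑ j : Deg m, (‖tracePotential (j : ℕ) X‖ : ℂ)‖
        = ∑ j : Deg m, ‖tracePotential (j : ℕ) X‖ := by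
      rw [← Complex.ofReal_sum, Complex.norm_real]
      exact Real.norm_of_nonneg (Finset.sum_nonneg fun j _ => norm_nonneg _)
    rw [norm_smul, norm_mul, norm_mul, norm_mul, norm_mul, norm_mul, hsum, Complex.norm_real,
      Complex.norm_real, norm_norm, Real.norm_of_nonneg hK0]
    calc _ ≤ ‖gaussWeight X‖ * (‖g X‖ * K) * ∑ j : Deg m, ‖tracePotential (j : ℕ) X‖ := by gcongr
      _ = _ := by ring
  · exact hbound.integrable.norm
  · refine ae_of_all _ fun X t _ => ?_
    have h2 := ((hasFDerivAt_exp_potential X t).const_mul (g X)).const_mul (gaussWeight X)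
    refine h2.congr_fderiv ?_
    simp only [smul_smul]

theorem differentiableAt_matrixIntegral {n m : ℕ} (hm : 2 ≤ m) {t : Deg m → ℂ}
    (ht : (t (topDeg m hm)).re < 0) : DifferentiableAt ℂ (matrixIntegral n m) t := by
  have h : matrixIntegral n m = fun t => (∫ X, gaussWeight X *
      (1 * Complex.exp (∑ j : Deg m, t j * tracePotential (j : ℕ) X)) ∂hermitianVolume n)
      * (_root_.gaussNorm n)⁻¹ := by
    funext t
    simp only [matrixIntegral, matrixIntegrand_eq, one_mul, div_eq_mul_inv]
  rw [h]
  exact (differentiableAt_integral_exp (n := n) hm (PolyGrowth.const 1) ht).mul_const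
    (_root_.gaussNorm n)⁻¹

/-! ### The coefficients of the expansion -/

/-- The coefficient of `∏ t_j^{v_j}` in `exp (tr ∑_j t_j X^j / j)`. -/
def potentialMonomial {n m : ℕ} (v : Deg m →₀ ℕ) (X : HermitianMatrix n) : ℂ :=
  ∏ j : Deg m, tracePotential (j : ℕ) X ^ v j / (v j).factorial

theorem polyGrowth_potentialMonomial {n m : ℕ} (v : Deg m →₀ ℕ) :
    PolyGrowth (potentialMonomial (n := n) v) := by
  unfold potentialMonomial
  simp only [div_eq_mul_inv]
  exact PolyGrowth.prod _ fun j _ =>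
    ((polyGrowth_tracePotential _).pow _).mul (PolyGrowth.const _)

/-- The coefficient `c_v(z)` of `∏_{j < 2m} t_j^{v_j}` in the matrix integral, as a function of
`z = t_{2m}`. -/
def expansionCoeff (n : ℕ) {m : ℕ} (hm : 2 ≤ m) (v : Deg m →₀ ℕ) (z : ℂ) : ℂ :=
  (∫ X, gaussWeight X * (potentialMonomial v X *
    Complex.exp (z * tracePotential (topDeg m hm : ℕ) X)) ∂hermitianVolume n) / _root_.gaussNorm n

theorem sum_single_mul_tracePotential {n m : ℕ} (hm : 2 ≤ m) (z : ℂ) (X : HermitianMatrix n) :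
    ∑ j : Deg m, (Pi.single (topDeg m hm) z : Deg m → ℂ) j * tracePotential (j : ℕ) X
      = z * tracePotential (topDeg m hm : ℕ) X := by
  rw [Finset.sum_eq_single (topDeg m hm)]
  · simp
  · intro j _ hj
    simp [hj]
  · simp

theorem differentiableAt_expansionCoeff (n : ℕ) {m : ℕ} (hm : 2 ≤ m) (v : Deg m →₀ ℕ) {z : ℂ}
    (hz : z.re < 0) : DifferentiableAt ℂ (expansionCoeff n hm v) z := by
  have h1 := differentiableAt_integral_exp hm (polyGrowth_potentialMonomial (n := n) v)
    (t₀ := Pi.single (topDeg m hm) z) (by simpa using hz)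
  have h2 : DifferentiableAt ℂ (fun z : ℂ => (Pi.single (topDeg m hm) z : Deg m → ℂ)) z :=
    (ContinuousLinearMap.single ℂ (fun _ : Deg m => ℂ) (topDeg m hm)).differentiableAt
  have h3 := (h1.comp z h2).div_const (_root_.gaussNorm n)
  refine h3.congr_of_eventuallyEq (.of_forall fun z => ?_)
  simp only [expansionCoeff, Function.comp_apply, sum_single_mul_tracePotential]

theorem potentialMonomial_add_single {n m : ℕ} (hm : 2 ≤ m) {v : Deg m →₀ ℕ}
    (hv : v (topDeg m hm) = 0) (k : ℕ) (X : HermitianMatrix n) :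
    potentialMonomial (v + Finsupp.single (topDeg m hm) k) X
      = potentialMonomial v X * (tracePotential (topDeg m hm : ℕ) X ^ k / k.factorial) := by
  unfold potentialMonomial
  rw [← Finset.mul_prod_erase _ _ (Finset.mem_univ (topDeg m hm)),
    ← Finset.mul_prod_erase _ _ (Finset.mem_univ (topDeg m hm)), mul_comm (_ * _)]
  congr 1
  · simp [hv]
  · simp only [hv, pow_zero, Nat.factorial_zero, Nat.cast_one, div_one, one_mul]
    refine Finset.prod_congr rfl fun j hj => ?_
    rw [Finsupp.add_apply, Finsupp.single_eq_of_ne (Finset.ne_of_mem_erase hj), add_zero]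

/-- The coefficients of the ribbon graph series are Gaussian expectations. -/
theorem coeff_ribbonSeries_eq_integral (n : ℕ) {m : ℕ} (v : Deg m →₀ ℕ) :
    MvPowerSeries.coeff v (MvPowerSeries.map
      (Polynomial.eval₂RingHom (algebraMap ℚ ℂ) (n : ℂ)) (ribbonSeries m))
      = (∫ X, gaussWeight X * potentialMonomial v X ∂hermitianVolume n) / _root_.gaussNorm n := by
  have h : ∀ X : HermitianMatrix n, gaussWeight X * potentialMonomial v X
      = (gaussWeight X * ∏ j : Deg m, (X.1 ^ (j : ℕ)).trace ^ v j)
        / ∏ j : Deg m, ((v j).factorial * (j : ℂ) ^ v j) := by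
    intro X
    rw [potentialMonomial, mul_div_assoc, ← Finset.prod_div_distrib]
    congr 1
    refine Finset.prod_congr rfl fun j _ => ?_
    rw [tracePotential, div_pow, div_div, mul_comm (_ ^ v j)]
  rw [coeff_ribbonSeries]
  simp only [h]
  rw [integral_div, integral_prod_trace_pow, mul_div_assoc,
    mul_div_cancel_left₀ _ (gaussNorm_ne_zero n)]

/-- Taylor's formula for `exp (z w)` under the integral, in the closed left half plane. -/
theorem exists_norm_integral_exp_sub_sum_le {n : ℕ} {g w : HermitianMatrix n → ℂ}
    (hg : PolyGrowth g) (hw : PolyGrowth w) (hw0 : ∀ X, ∃ r : ℝ, 0 ≤ r ∧ w X = r)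
    (hE : ∀ z : ℂ, z.re < 0 → PolyGrowth fun X => Complex.exp (z * w X)) (N : ℕ) :
    ∃ C : ℝ, ∀ z : ℂ, z.re < 0 →
      ‖(∫ X, gaussWeight X * (g X * Complex.exp (z * w X)) ∂hermitianVolume n)
        - ∑ k ∈ Finset.range N,
          (∫ X, gaussWeight X * (g X * (w X ^ k / k.factorial)) ∂hermitianVolume n) * z ^ k‖
        ≤ C * ‖z‖ ^ N := by
  refine ⟨∫ X, ‖gaussWeight X * (g X * w X ^ N)‖ ∂hermitianVolume n, fun z hz => ?_⟩
  have hterm : ∀ k, Integrable (fun X => gaussWeight X * (g X * (w X ^ k / k.factorial)))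
      (hermitianVolume n) := fun k => by
    simp only [div_eq_mul_inv]
    exact (hg.mul ((hw.pow k).mul (PolyGrowth.const _))).integrable
  simp only [← integral_mul_const]
  rw [← integral_finsetSum _ fun k _ => (hterm k).mul_const _,
    ← integral_sub (hg.mul (hE z hz)).integrable
      (integrable_finsetSum _ fun k _ => (hterm k).mul_const _)]
  refine (norm_integral_le_integral_norm _).trans ?_
  refine integral_mono_of_nonneg (ae_of_all _ fun X => norm_nonneg _)
    ((hg.mul (hw.pow N)).integrable.norm.mul_const _) (ae_of_all _ fun X => ?_)
  obtain ⟨r, hr, hr'⟩ := hw0 X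
  have h1 : gaussWeight X * (g X * Complex.exp (z * w X))
      - ∑ k ∈ Finset.range N, gaussWeight X * (g X * (w X ^ k / k.factorial)) * z ^ k
      = gaussWeight X * g X * (Complex.exp (z * w X)
        - ∑ k ∈ Finset.range N, (z * w X) ^ k / k.factorial) := by
    rw [mul_sub, Finset.mul_sum, mul_assoc]
    congr 1
    refine Finset.sum_congr rfl fun k _ => ?_
    rw [mul_pow]
    ring
  have h2 := norm_exp_sub_sum_le_of_re_nonpos N (y := z * w X) (by
    rw [hr', Complex.re_mul_ofReal]
    exact mul_nonpos_of_nonpos_of_nonneg hz.le hr)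
  simp only [h1]
  rw [norm_mul]
  calc _ ≤ ‖gaussWeight X * g X‖ * ‖z * w X‖ ^ N := by gcongr
    _ = ‖gaussWeight X * (g X * w X ^ N)‖ * ‖z‖ ^ N := by
      simp only [norm_mul, norm_pow, mul_pow]; ring

/-- The remainder after one more term than needed is divided by `z ^ (M + 1)`; it is
`O(|z| ^ (M + 2))`, so the quotient tends to the coefficient of `z ^ (M + 1)`. -/
theorem hasAsymptoticExpansion_expansionCoeff (n : ℕ) {m : ℕ} (hm : 2 ≤ m) {ε : ℝ} (hε : 0 < ε)
    (hε' : ε < Real.pi / 2) {v : Deg m →₀ ℕ} (hv : v (topDeg m hm) = 0) :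
    HasAsymptoticExpansion (sector ε) (expansionCoeff n hm v)
      (fun k => MvPowerSeries.coeff (v + Finsupp.single (topDeg m hm) k) (MvPowerSeries.map
        (Polynomial.eval₂RingHom (algebraMap ℚ ℂ) (n : ℂ)) (ribbonSeries m))) where
  isOpen := isOpen_sector hε
  isPreconnected := isPreconnected_sector ε
  zero_mem_frontier := zero_mem_frontier_sector hε hε'
  holomorphic := fun z hz => (differentiableAt_expansionCoeff n hm v
    (re_neg_of_mem_sector hε hz)).differentiableWithinAt
  tendsto := by
    intro M
    have hE : ∀ z : ℂ, z.re < 0 → PolyGrowth fun X : HermitianMatrix n =>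
        Complex.exp (z * tracePotential (topDeg m hm : ℕ) X) := by
      intro z hz
      have := polyGrowth_exp (n := n) hm (t := Pi.single (topDeg m hm) z) (by simpa using hz)
      simpa only [sum_single_mul_tracePotential] using this
    obtain ⟨C, hC⟩ := exists_norm_integral_exp_sub_sum_le
      (polyGrowth_potentialMonomial (n := n) v) (polyGrowth_tracePotential (topDeg m hm : ℕ))
      (tracePotential_topDeg hm) hE (M + 2)
    simp only [coeff_ribbonSeries_eq_integral, potentialMonomial_add_single hm hv]
    set a : ℕ → ℂ := fun k => (∫ X, gaussWeight X * (potentialMonomial v X *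
      (tracePotential (topDeg m hm : ℕ) X ^ k / k.factorial)) ∂hermitianVolume n)
      / _root_.gaussNorm n with ha
    rw [tendsto_iff_norm_sub_tendsto_zero]
    refine squeeze_zero' (.of_forall fun _ => norm_nonneg _)
      (g := fun z : ℂ => C / ‖_root_.gaussNorm n‖ * ‖z‖) ?_ ?_
    · filter_upwards [self_mem_nhdsWithin] with z hz
      have hre := re_neg_of_mem_sector hε hz
      have hz0 : z ≠ 0 := fun h => by simp [h] at hre
      have h1 : (expansionCoeff n hm v z - ∑ k ∈ Finset.range (M + 1), a k * z ^ k) / z ^ (M + 1)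
          - a (M + 1) = (expansionCoeff n hm v z - ∑ k ∈ Finset.range (M + 2), a k * z ^ k)
            / z ^ (M + 1) := by
        rw [Finset.sum_range_succ _ (M + 1), ← sub_sub, sub_div _ (a (M + 1) * _),
          mul_div_cancel_right₀ _ (pow_ne_zero _ hz0)]
      have h2 : expansionCoeff n hm v z - ∑ k ∈ Finset.range (M + 2), a k * z ^ k
          = ((∫ X, gaussWeight X * (potentialMonomial v X *
              Complex.exp (z * tracePotential (topDeg m hm : ℕ) X)) ∂hermitianVolume n)
            - ∑ k ∈ Finset.range (M + 2), (∫ X, gaussWeight X * (potentialMonomial v X *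
              (tracePotential (topDeg m hm : ℕ) X ^ k / k.factorial)) ∂hermitianVolume n) * z ^ k)
            / _root_.gaussNorm n := by
        rw [sub_div, Finset.sum_div, expansionCoeff]
        congr 1
        exact Finset.sum_congr rfl fun k _ => div_mul_eq_mul_div _ _ _
      change ‖_ / z ^ (M + 1) - a (M + 1)‖ ≤ _
      rw [h1, h2, norm_div, norm_div, norm_pow, div_le_iff₀ (by positivity), div_mul_eq_mul_div,
        div_mul_eq_mul_div]
      gcongr
      refine (hC z hre).trans_eq ?_
      ring
    · have : Continuous fun z : ℂ => C / ‖_root_.gaussNorm n‖ * ‖z‖ := by fun_prop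
      exact (this.tendsto' 0 0 (by simp)).mono_left nhdsWithin_le_nhds

/-! ### The expansion in the lower variables -/

/-- Termwise integration; the sum of the norms of the terms is again an integrand of the same kind,
with `t_j w_j` replaced by `|t_j w_j|` for `j < 2m`. -/
theorem hasSum_expansionCoeff (n : ℕ) {m : ℕ} (hm : 2 ≤ m) {t : Deg m → ℂ}
    (ht : (t (topDeg m hm)).re < 0) :
    HasSum (fun v : {v : Deg m →₀ ℕ // v (topDeg m hm) = 0} =>
      expansionCoeff n hm v.1 (t (topDeg m hm)) * ∏ i, t i ^ v.1 i) (matrixIntegral n m t) := by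
  set i₀ := topDeg m hm
  let F : {v : Deg m →₀ ℕ // v i₀ = 0} → HermitianMatrix n → ℂ := fun v X =>
    gaussWeight X * (potentialMonomial v.1 X * Complex.exp (t i₀ * tracePotential (i₀ : ℕ) X)) *
      ∏ i, t i ^ v.1 i
  have hF : ∀ v X, F v X = gaussWeight X * Complex.exp (t i₀ * tracePotential (i₀ : ℕ) X) *
      ∏ j : Deg m, (t j * tracePotential (j : ℕ) X) ^ v.1 j / (v.1 j).factorial := by
    intro v X
    have : ∏ j : Deg m, (t j * tracePotential (j : ℕ) X) ^ v.1 j / ((v.1 j).factorial : ℂ)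
        = potentialMonomial v.1 X * ∏ i, t i ^ v.1 i := by
      rw [potentialMonomial, ← Finset.prod_mul_distrib]
      exact Finset.prod_congr rfl fun j _ => by rw [mul_pow]; ring
    rw [this]
    ring
  have hFc : ∀ v, Continuous (F v) := fun v =>
    (continuous_gaussWeight.mul ((polyGrowth_potentialMonomial v.1).continuous.mul
      (Complex.continuous_exp.comp (continuous_const.mul
        (polyGrowth_tracePotential _).continuous)))).mul continuous_const
  have hnorm : ∀ X, HasSum (fun v => ‖F v X‖) ‖gaussWeight X * Complex.exp (t i₀ *
      tracePotential (i₀ : ℕ) X +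
        ∑ j ∈ Finset.univ.erase i₀, ‖t j * tracePotential (j : ℕ) X‖)‖ := by
    intro X
    have h1 := hasSum_prod_pow_div_factorial i₀ fun j : Deg m =>
      ((‖t j * tracePotential (j : ℕ) X‖ : ℝ) : ℂ)
    have h2 : HasSum (fun v : {v : Deg m →₀ ℕ // v i₀ = 0} =>
        ∏ j, ‖t j * tracePotential (j : ℕ) X‖ ^ v.1 j / (v.1 j).factorial)
        (Real.exp (∑ j ∈ Finset.univ.erase i₀, ‖t j * tracePotential (j : ℕ) X‖)) := by
      exact_mod_cast h1
    have h3 := h2.mul_left ‖gaussWeight X * Complex.exp (t i₀ * tracePotential (i₀ : ℕ) X)‖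
    rw [Complex.exp_add, ← mul_assoc, norm_mul, ← Complex.ofReal_exp, Complex.norm_real,
      Real.norm_of_nonneg (Real.exp_pos _).le]
    have h4 : (fun v => ‖F v X‖) = fun v : {v : Deg m →₀ ℕ // v i₀ = 0} =>
        ‖gaussWeight X * Complex.exp (t i₀ * tracePotential (i₀ : ℕ) X)‖ *
          ∏ j, ‖t j * tracePotential (j : ℕ) X‖ ^ v.1 j / (v.1 j).factorial := by
      funext v
      rw [hF, norm_mul, norm_prod]
      simp only [norm_div, norm_pow, Complex.norm_natCast]
    rw [h4]
    exact h3
  obtain ⟨K, hK⟩ := exists_sum_norm_tracePotential_le n hm (neg_pos.2 ht) (norm_nonneg t)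
  have hbound : PolyGrowth fun X : HermitianMatrix n => Complex.exp (t i₀ *
      tracePotential (i₀ : ℕ) X +
        ∑ j ∈ Finset.univ.erase i₀, ‖t j * tracePotential (j : ℕ) X‖) := by
    refine PolyGrowth.of_bounded (Complex.continuous_exp.comp ((continuous_const.mul
      (polyGrowth_tracePotential _).continuous).add (Complex.continuous_ofReal.comp
        (continuous_finsetSum _ fun j _ =>
          (continuous_const.mul (polyGrowth_tracePotential _).continuous).norm)))) (Real.exp K)
      fun X => ?_
    rw [Complex.norm_exp, Real.exp_le_exp, Complex.add_re, Complex.ofReal_re]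
    have h1 := hK X
    obtain ⟨r, hr, hr'⟩ := tracePotential_topDeg hm X
    rw [hr', Complex.ofReal_re] at h1
    rw [hr', Complex.re_mul_ofReal]
    have h2 : ∑ j ∈ Finset.univ.erase i₀, ‖t j * tracePotential (j : ℕ) X‖
        ≤ ∑ j ∈ Finset.univ.erase i₀, ‖t‖ * ‖tracePotential (j : ℕ) X‖ := by
      refine Finset.sum_le_sum fun j _ => ?_
      rw [norm_mul]
      gcongr
      exact norm_le_pi_norm t j
    linarith
  have hint := hasSum_integral_of_dominated_convergence (μ := hermitianVolume n) (F := F)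
    (f := matrixIntegrand n m t) (fun v X => ‖F v X‖)
    (fun v => (hFc v).aestronglyMeasurable) (fun v => ae_of_all _ fun X => le_rfl)
    (ae_of_all _ fun X => (hnorm X).summable)
    (by simp only [fun X => (hnorm X).tsum_eq]; exact hbound.integrable.norm)
    (ae_of_all _ fun X => by
      have h1 := (hasSum_prod_pow_div_factorial i₀ fun j : Deg m =>
        t j * tracePotential (j : ℕ) X).mul_left
        (gaussWeight X * Complex.exp (t i₀ * tracePotential (i₀ : ℕ) X))
      rw [mul_assoc, ← Complex.exp_add, Finset.add_sum_erase _ (fun j : Deg m =>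
        t j * tracePotential (j : ℕ) X) (Finset.mem_univ i₀), ← matrixIntegrand_eq] at h1
      simpa only [hF] using h1)
  have h := hint.div_const (_root_.gaussNorm n)
  have h3 : (fun v : {v : Deg m →₀ ℕ // v i₀ = 0} =>
      expansionCoeff n hm v.1 (t i₀) * ∏ i, t i ^ v.1 i)
      = fun v => (∫ X, F v X ∂hermitianVolume n) / _root_.gaussNorm n := by
    funext v
    rw [integral_mul_const, expansionCoeff, div_mul_eq_mul_div]
  rw [h3]
  exact h

end

theorem theorem2p4 (m : ℕ) (hm : 2 ≤ m) (n : ℕ) (ε : ℝ) (hε : 0 < ε) (hε' : ε < Real.pi / 2) :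
    (∀ t : Deg m → ℂ, t (topDeg m hm) ∈ sector ε →
      Integrable (matrixIntegrand n m t) (hermitianVolume n)) ∧
    IsMixedExpansion (topDeg m hm) (sector ε) (matrixIntegral n m)
      (MvPowerSeries.map (Polynomial.eval₂RingHom (algebraMap ℚ ℂ) (n : ℂ)) (ribbonSeries m)) := by
  refine ⟨fun t ht => ?_, fun t ht => ?_, fun v => expansionCoeff n hm v.1, fun t ht => ?_,
    fun v => ?_⟩
  · simpa only [← matrixIntegrand_eq] using
      (polyGrowth_exp (n := n) hm (re_neg_of_mem_sector hε ht)).integrable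
  · exact (differentiableAt_matrixIntegral hm
      (re_neg_of_mem_sector hε ht)).differentiableWithinAt
  · exact hasSum_expansionCoeff n hm (re_neg_of_mem_sector hε ht)
  · exact hasAsymptoticExpansion_expansionCoeff n hm hε hε' v.2
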